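/- Let $L$ be an even positive integer, $\Lambda=(\mathbb Z/L\mathbb Z)^2$, $\mathcal S=\{-1,+1\}^\Lambda$, $0<h<1$, $\lambda=\lfloor 2/h\rfloor+1$, $\Gamma_{\mathrm m}=-2h\lambda^2+2(4+h)\lambda-2h$, and assume $L>2\lambda$. For $\beta>0$ and $\sigma\in\mathcal S$ let $S_\sigma(x)$ be the sum of $\sigma$ over the four nearest neighbours of $x$, let $$p(\sigma,\eta)=\prod_{x\in\Lambda}\frac1{1+e^{-2\beta\eta(x)(S_\sigma(x)+h)}},\qquad H(\sigma)=-h\sum_{x}\sigma(x)-\frac1\beta\sum_{x}\log\cosh[\beta(S_\sigma(x)+h)],$$ and let $\mu(\sigma)=e^{-\beta H(\sigma)}/\sum_{\eta}e^{-\beta H(\eta)}$ be the Gibbs measure. For disjoint non-empty $A,B\subset\mathcal S$ put $$\mathrm{cap}_\beta(A,B)=\min\Big\{\tfrac12\sum_{\sigma,\eta\in\mathcal S}\mu(\sigma)p(\sigma,\eta)[f(\sigma)-f(\eta)]^2\;:\;f:\mathcal S\to[0,1],\ f|_A=1,\ f|_B=0\Big\}.$$ Let $\mathbf d\equiv-1$,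 $\mathbf u\equiv+1$, $\mathbf c^{\mathrm e}(x)=(-1)^{x_1+x_2}$, $\mathbf c^{\mathrm o}=-\mathbf c^{\mathrm e}$, $\mathbf c=\{\mathbf c^{\mathrm e},\mathbf c^{\mathrm o}\}$ and $\mu(\mathbf c)=\mu(\mathbf c^{\mathrm e})+\mu(\mathbf c^{\mathrm o})$. Then there are constants $0<k_1,k_2<\infty$, not depending on $\beta$, such that, as $\beta\to\infty$, $$\frac{\mu(\mathbf d)}{\mathrm{cap}_\beta(\mathbf d,\{\mathbf c,\mathbf u\})}=\frac{e^{\beta\Gamma_{\mathrm m}}}{k_2}[1+o(1)]\qquad\text{and}\qquad\frac{\mu(\mathbf c)}{\mathrm{cap}_\beta(\mathbf c,\mathbf u)}=\frac{e^{\beta\Gamma_{\mathrm m}}}{k_1}[1+o(1)].$$ If moreover $2/h$ is not an integer, then $k_2=4\lambda L^2$, the number of ways to place a $\lambda\times(\lambda-1)$ rectangle on the torus (in either orientation), fill it with one of the two checkerboards, and attach a protuberance to one of its longer sides next to a plus spin; and $k_1=2\lambda L^2$. -/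

import Mathlib

noncomputable section

namespace PCA

/-- The two-dimensional torus of side length `L`. -/
abbrev Torus (L : ℕ) : Type := ZMod L × ZMod L

/-- Spin configurations: every site carries a spin `-1` or `+1`. -/
abbrev Config (L : ℕ) : Type := Torus L → ℤˣ

/-- The real value of a spin. -/
def spin (s : ℤˣ) : ℝ := ((s : ℤ) : ℝ)

/-- The interaction kernel: `1` for a displacement of length one on the torus, `0` otherwise. -/
def kernel {L : ℕ} (z : Torus L) : ℝ :=
  if z = (1, 0) ∨ z = (-1, 0) ∨ z = (0, 1) ∨ z = (0, -1) then 1 else 0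

/-- `S_σ(x) = ∑_y K(x - y) σ(y)`. -/
def localField {L : ℕ} [NeZero L] (σ : Config L) (x : Torus L) : ℝ :=
  ∑ y : Torus L, kernel (x - y) * spin (σ y)

/-- `p_{x,σ}(s)`, the probability that the spin at `x` is updated to `s`. -/
def siteProb {L : ℕ} [NeZero L] (β h : ℝ) (σ : Config L) (x : Torus L) (s : ℤˣ) : ℝ :=
  1 / (1 + Real.exp (-2 * β * spin s * (localField σ x + h)))

/-- The transition matrix of the chain: all the spins are updated simultaneously and
independently. -/
def transProb {L : ℕ} [NeZero L] (β h : ℝ) (σ η : Config L) : ℝ :=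
  ∏ x : Torus L, siteProb β h σ x (η x)

/-- The Hamiltonian `H`, which depends on `β`. -/
def hamiltonian {L : ℕ} [NeZero L] (β h : ℝ) (σ : Config L) : ℝ :=
  -h * ∑ x : Torus L, spin (σ x)
    - (1 / β) * ∑ x : Torus L, Real.log (Real.cosh (β * (localField σ x + h)))

/-- The partition function `Z`. -/
def partitionFun (L : ℕ) [NeZero L] (β h : ℝ) : ℝ :=
  ∑ η : Config L, Real.exp (-β * hamiltonian β h η)

/-- The Gibbs weight `μ(σ)` of a configuration. -/
def gibbs {L : ℕ} [NeZero L] (β h : ℝ) (σ : Config L) : ℝ :=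
  Real.exp (-β * hamiltonian β h σ) / partitionFun L β h

/-- The Gibbs measure `μ(A)` of a finite set of configurations. -/
def gibbsSet {L : ℕ} [NeZero L] (β h : ℝ) (A : Finset (Config L)) : ℝ :=
  ∑ σ ∈ A, gibbs β h σ

/-- The Dirichlet form of the reversible chain. -/
def dirichlet {L : ℕ} [NeZero L] (β h : ℝ) (f : Config L → ℝ) : ℝ :=
  (1 / 2) * ∑ σ : Config L, ∑ η : Config L,
    gibbs β h σ * transProb β h σ η * (f σ - f η) ^ 2

/-- The capacity of a pair of (disjoint, non-empty) sets of configurations: the minimum of the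
Dirichlet form over the functions with values in `[0,1]`, equal to `1` on `A` and to `0` on `B`. -/
def capacity {L : ℕ} [NeZero L] (β h : ℝ) (A B : Finset (Config L)) : ℝ :=
  sInf (dirichlet β h ''
    {f : Config L → ℝ | (∀ σ, 0 ≤ f σ ∧ f σ ≤ 1) ∧ (∀ σ ∈ A, f σ = 1) ∧ (∀ σ ∈ B, f σ = 0)})

/-- The configuration `d`: all spins are minus. -/
def allMinus (L : ℕ) : Config L := fun _ => -1

/-- The configuration `u`: all spins are plus. -/
def allPlus (L : ℕ) : Config L := fun _ => 1

/-- The checkerboard `c^e`, with the pluses on the even sublattice. -/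
def checkerEven (L : ℕ) : Config L := fun x => (-1) ^ (x.1.val + x.2.val)

/-- The checkerboard `c^o`, with the pluses on the odd sublattice. -/
def checkerOdd (L : ℕ) : Config L := fun x => (-1) ^ (x.1.val + x.2.val + 1)

open Classical in
/-- The pair `c = {c^e, c^o}`. -/
def checkers (L : ℕ) : Finset (Config L) := {checkerEven L, checkerOdd L}

open Classical in
/-- The set `{c, u} = {c^e, c^o, u}`. -/
def checkersPlus (L : ℕ) : Finset (Config L) := {checkerEven L, checkerOdd L, allPlus L}

/-- The critical length `λ = ⌊2/h⌋ + 1`. -/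
def critLength (h : ℝ) : ℕ := ⌊2 / h⌋₊ + 1

/-- The activation energy `Γ_m = -2hλ² + 2(4+h)λ - 2h`. -/
def activationEnergy (h : ℝ) : ℝ :=
  -2 * h * (critLength h : ℝ) ^ 2 + 2 * (4 + h) * (critLength h : ℝ) - 2 * h

end PCA

end

/-!
Split a transition `σ → η` by parity: `σ` on the even sites and `η` on the odd ones make up one
configuration, `η` on the even sites and `σ` on the odd ones another. Since neighbours have opposite
parities, the conductance `μ(σ) p(σ, η)` factorizes: up to a constant it is `exp (-β E)`, where `E`
is the sum of the two Ising energies, twice the perimeter minus `2 h` times the area of the set of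
pluses. The chain thus moves between pairs of droplets by exchanging or modifying one of the two;
on the exit from `d` one droplet stays empty, on the exit from `c` one droplet stays full, and the
other one has to nucleate. The isoperimetric inequality on the torus gives the barrier, whose
saddles for noninteger `2 / h` are the `m × (m + 1)` rectangles, `m = ⌊2 / h⌋`, with a protuberance
on a longer side.

The capacity is squeezed between two applications of the Dirichlet principle. The indicator of the
subcritical pairs is a cut all of whose edges have at least the critical energy, and paths of
growing droplets connect the two sides of the cut without exceeding it. When `2 / h` is not an
integer, each critical droplet is linked strictly below the barrier to both ends, so to leading
order the network is a bundle of parallel unit edges and its capacity is their number.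
-/

noncomputable section

open Filter Topology

namespace PCA

section Network

variable {V : Type*}

/-- The potentials admissible in the Dirichlet principle for the capacity of the pair `A`, `B`. -/
def potentials (A B : Finset V) : Set (V → ℝ) :=
  {f | (∀ σ, 0 ≤ f σ ∧ f σ ≤ 1) ∧ (∀ σ ∈ A, f σ = 1) ∧ (∀ σ ∈ B, f σ = 0)}

lemma sq_sub_le_one_of_mem_potentials {A B : Finset V} {f : V → ℝ} (hf : f ∈ potentials A B)
    (σ η : V) : (f σ - f η) ^ 2 ≤ 1 := by
  have hσ := hf.1 σ
  have hη := hf.1 η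
  exact (sq_le_one_iff_abs_le_one _).2 (abs_le.2 ⟨by linarith, by linarith⟩)

variable [Fintype V]

/-- The Dirichlet form of the network with conductances `c`, summed over oriented edges. -/
def dirichletForm (c : V → V → ℝ) (f : V → ℝ) : ℝ :=
  (1 / 2) * ∑ σ, ∑ η, c σ η * (f σ - f η) ^ 2

/-- The capacity between `A` and `B` of the network with conductances `c`. -/
def networkCapacity (c : V → V → ℝ) (A B : Finset V) : ℝ :=
  sInf (dirichletForm c '' potentials A B)

lemma dirichletForm_eq_sum_prod (c : V → V → ℝ) (f : V → ℝ) :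
    dirichletForm c f = (1 / 2) * ∑ p : V × V, c p.1 p.2 * (f p.1 - f p.2) ^ 2 := by
  rw [dirichletForm, Fintype.sum_prod_type]

lemma dirichletForm_nonneg {c : V → V → ℝ} (hc : 0 ≤ c) (f : V → ℝ) : 0 ≤ dirichletForm c f :=
  mul_nonneg (by norm_num) <| Finset.sum_nonneg fun σ _ => Finset.sum_nonneg fun η _ =>
    mul_nonneg (hc σ η) (sq_nonneg _)

lemma dirichletForm_mono {c c' : V → V → ℝ} (hc : c ≤ c') (f : V → ℝ) :
    dirichletForm c f ≤ dirichletForm c' f :=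
  mul_le_mul_of_nonneg_left (Finset.sum_le_sum fun σ _ => Finset.sum_le_sum fun η _ =>
    mul_le_mul_of_nonneg_right (hc σ η) (sq_nonneg _)) (by norm_num)

lemma dirichletForm_const_mul (a : ℝ) (c : V → V → ℝ) (f : V → ℝ) :
    dirichletForm (fun σ η => a * c σ η) f = a * dirichletForm c f := by
  simp only [dirichletForm, mul_assoc, ← Finset.mul_sum]
  ring

lemma sum_mul_sq_sub_le_dirichletForm {c : V → V → ℝ} (hc : 0 ≤ c) (T : Finset (V × V))
    (f : V → ℝ) : ∑ p ∈ T, c p.1 p.2 * (f p.1 - f p.2) ^ 2 ≤ 2 * dirichletForm c f := by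
  have hsub : ∑ p ∈ T, c p.1 p.2 * (f p.1 - f p.2) ^ 2
      ≤ ∑ p : V × V, c p.1 p.2 * (f p.1 - f p.2) ^ 2 :=
    Finset.sum_le_sum_of_subset_of_nonneg T.subset_univ fun p _ _ =>
      mul_nonneg (hc p.1 p.2) (sq_nonneg _)
  rw [dirichletForm_eq_sum_prod]
  linarith

lemma dirichletForm_le_add {c c' : V → V → ℝ} {ε : ℝ} (hε : 0 ≤ ε)
    (hc : ∀ σ η, c σ η ≤ c' σ η + ε) {A B : Finset V} {f : V → ℝ} (hf : f ∈ potentials A B) :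
    dirichletForm c f ≤ dirichletForm c' f + (Fintype.card V : ℝ) ^ 2 / 2 * ε := by
  have hedge : ∀ σ η, c σ η * (f σ - f η) ^ 2 ≤ c' σ η * (f σ - f η) ^ 2 + ε := fun σ η => by
    nlinarith [mul_le_mul_of_nonneg_right (hc σ η) (sq_nonneg (f σ - f η)),
      sq_sub_le_one_of_mem_potentials hf σ η]
  have hsum := Finset.sum_le_sum fun σ (_ : σ ∈ Finset.univ) =>
    Finset.sum_le_sum fun η (_ : η ∈ Finset.univ) => hedge σ η
  simp only [Finset.sum_add_distrib, Finset.sum_const, Finset.card_univ, nsmul_eq_mul] at hsum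
  unfold dirichletForm
  linarith

lemma networkCapacity_le {c : V → V → ℝ} (hc : 0 ≤ c) {A B : Finset V} {f : V → ℝ}
    (hf : f ∈ potentials A B) : networkCapacity c A B ≤ dirichletForm c f :=
  csInf_le ⟨0, by rintro _ ⟨g, -, rfl⟩; exact dirichletForm_nonneg hc g⟩ ⟨f, hf, rfl⟩

lemma le_networkCapacity {c : V → V → ℝ} {a : ℝ} {A B : Finset V}
    (hne : (potentials A B).Nonempty) (h : ∀ f ∈ potentials A B, a ≤ dirichletForm c f) :
    a ≤ networkCapacity c A B :=
  le_csInf (hne.image _) (by rintro _ ⟨g, hg, rfl⟩; exact h g hg)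

lemma networkCapacity_mono {c c' : V → V → ℝ} (hc : 0 ≤ c) (hcc' : c ≤ c') {A B : Finset V}
    (hne : (potentials A B).Nonempty) : networkCapacity c A B ≤ networkCapacity c' A B :=
  le_networkCapacity hne fun f hf => (networkCapacity_le hc hf).trans (dirichletForm_mono hcc' f)

lemma networkCapacity_le_add {c c' : V → V → ℝ} (hc : 0 ≤ c) {ε : ℝ} (hε : 0 ≤ ε)
    (hcc' : ∀ σ η, c σ η ≤ c' σ η + ε) {A B : Finset V} (hne : (potentials A B).Nonempty) :
    networkCapacity c A B ≤ networkCapacity c' A B + (Fintype.card V : ℝ) ^ 2 / 2 * ε := by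
  rw [← sub_le_iff_le_add]
  exact le_networkCapacity hne fun f hf => sub_le_iff_le_add.2 <|
    (networkCapacity_le hc hf).trans (dirichletForm_le_add hε hcc' hf)

lemma networkCapacity_const_mul {a : ℝ} (ha : 0 ≤ a) (c : V → V → ℝ) (A B : Finset V) :
    networkCapacity (fun σ η => a * c σ η) A B = a * networkCapacity c A B := by
  rw [networkCapacity, networkCapacity, ← smul_eq_mul, ← Real.sInf_smul_of_nonneg ha]
  congr 1
  ext x
  simp [Set.mem_smul_set, dirichletForm_const_mul]

end Network

section LowTemperature

lemma exists_energy_gap {ι : Type*} [Finite ι] (E : ι → ℝ) (Γ : ℝ) :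
    ∃ ε > 0, ∀ i, E i ≠ Γ → ε ≤ |E i - Γ| := by
  have hfin : (E ⁻¹' {Γ}ᶜ).Finite := Set.toFinite _
  rcases (E ⁻¹' {Γ}ᶜ).eq_empty_or_nonempty with hempty | hne
  · exact ⟨1, one_pos, fun i hi => absurd hi (Set.eq_empty_iff_forall_notMem.1 hempty i)⟩
  · obtain ⟨i, hi, hmin⟩ := Set.exists_min_image _ (fun i => |E i - Γ|) hfin hne
    exact ⟨|E i - Γ|, abs_pos.2 (sub_ne_zero.2 hi), hmin⟩

lemma tendsto_exp_neg_mul {ε : ℝ} (hε : 0 < ε) :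
    Tendsto (fun β : ℝ => Real.exp (-β * ε)) atTop (𝓝 0) := by
  refine Real.tendsto_exp_atBot.comp ?_
  simpa using (tendsto_neg_atTop_atBot (G := ℝ)).atBot_mul_const hε

variable {V : Type*}

/-- Conductances of Boltzmann type, rescaled so that edges of energy `Γ` have conductance one. -/
def boltzmann (E : V → V → ℝ) (Γ β : ℝ) (σ η : V) : ℝ := Real.exp (-β * (E σ η - Γ))

open Classical in
/-- The conductances `boltzmann` restricted to the edges of energy at most `Γ`, which are the ones
that survive as `β → ∞`. -/
def lowBoltzmann (E : V → V → ℝ) (Γ β : ℝ) (σ η : V) : ℝ :=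
  if E σ η ≤ Γ then boltzmann E Γ β σ η else 0

variable {E : V → V → ℝ} {Γ : ℝ}

lemma boltzmann_nonneg (β : ℝ) : 0 ≤ boltzmann E Γ β := fun _ _ => (Real.exp_pos _).le

lemma lowBoltzmann_nonneg (β : ℝ) : 0 ≤ lowBoltzmann E Γ β := fun σ η => by
  unfold lowBoltzmann boltzmann
  split_ifs <;> positivity

lemma lowBoltzmann_le_boltzmann (β : ℝ) : lowBoltzmann E Γ β ≤ boltzmann E Γ β := fun σ η => by
  unfold lowBoltzmann
  split_ifs
  · exact le_rfl
  · exact boltzmann_nonneg β σ η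

lemma lowBoltzmann_mono : Monotone (lowBoltzmann E Γ) := fun β β' hβ σ η => by
  unfold lowBoltzmann boltzmann
  split_ifs
  · exact Real.exp_le_exp.2 (by nlinarith)
  · exact le_rfl

lemma boltzmann_le_lowBoltzmann_add {ε β : ℝ} (hβ : 0 ≤ β)
    (hgap : ∀ p : V × V, E p.1 p.2 ≠ Γ → ε ≤ |E p.1 p.2 - Γ|) (σ η : V) :
    boltzmann E Γ β σ η ≤ lowBoltzmann E Γ β σ η + Real.exp (-β * ε) := by
  unfold lowBoltzmann boltzmann
  split_ifs with hlow
  · linarith [Real.exp_pos (-β * ε)]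
  · have hE : ε ≤ E σ η - Γ := by
      have hlt := not_le.1 hlow
      simpa only [abs_of_pos (sub_pos.2 hlt)] using hgap (σ, η) hlt.ne'
    rw [zero_add]
    exact Real.exp_le_exp.2 (by nlinarith)

variable [Fintype V]

lemma dirichletForm_lowBoltzmann_of_cut {f : V → ℝ} (hcut : ∀ σ η, f σ ≠ f η → Γ ≤ E σ η)
    (β : ℝ) : dirichletForm (lowBoltzmann E Γ β) f =
      (1 / 2) * ∑ p : V × V with E p.1 p.2 = Γ, (f p.1 - f p.2) ^ 2 := by
  rw [dirichletForm_eq_sum_prod, Finset.sum_filter]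
  congr 1
  refine Finset.sum_congr rfl fun p _ => ?_
  by_cases hf : f p.1 = f p.2
  · simp [hf]
  · have hE : E p.1 p.2 ≤ Γ ↔ E p.1 p.2 = Γ := (hcut _ _ hf).ge_iff_eq'
    by_cases hΓ : E p.1 p.2 = Γ <;> simp [lowBoltzmann, boltzmann, hE, hΓ]

lemma exists_sq_sub_le_of_eqvGen {ε : ℝ} {σ η : V}
    (h : Relation.EqvGen (fun σ η => E σ η ≤ Γ - ε) σ η) :
    ∃ c : ℝ, 0 < c ∧ ∀ β : ℝ, 0 ≤ β → ∀ f : V → ℝ,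
      (f σ - f η) ^ 2 ≤ c * Real.exp (-β * ε) * dirichletForm (boltzmann E Γ β) f := by
  induction h with
  | rel σ η hE =>
    refine ⟨2, by norm_num, fun β hβ f => ?_⟩
    have hedge : boltzmann E Γ β σ η * (f σ - f η) ^ 2 ≤ 2 * dirichletForm (boltzmann E Γ β) f := by
      simpa using sum_mul_sq_sub_le_dirichletForm (boltzmann_nonneg β) {(σ, η)} f
    have hone : 1 ≤ Real.exp (-β * ε) * boltzmann E Γ β σ η := by
      rw [boltzmann, ← Real.exp_add]
      exact Real.one_le_exp (by nlinarith)
    calc (f σ - f η) ^ 2 ≤ Real.exp (-β * ε) * boltzmann E Γ β σ η * (f σ - f η) ^ 2 :=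
          le_mul_of_one_le_left (sq_nonneg _) hone
      _ = Real.exp (-β * ε) * (boltzmann E Γ β σ η * (f σ - f η) ^ 2) := mul_assoc _ _ _
      _ ≤ Real.exp (-β * ε) * (2 * dirichletForm (boltzmann E Γ β) f) := by gcongr
      _ = _ := by ring
  | refl σ =>
    refine ⟨1, one_pos, fun β _ f => ?_⟩
    have := dirichletForm_nonneg (boltzmann_nonneg (E := E) (Γ := Γ) β) f
    rw [sub_self, zero_pow two_ne_zero]
    positivity
  | symm σ η _ ih =>
    obtain ⟨c, hc, hle⟩ := ih
    exact ⟨c, hc, fun β hβ f => sub_sq_comm (f η) (f σ) ▸ hle β hβ f⟩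
  | trans σ τ η _ _ ih ih' =>
    obtain ⟨c, hc, hle⟩ := ih
    obtain ⟨c', hc', hle'⟩ := ih'
    refine ⟨2 * (c + c'), by positivity, fun β hβ f => ?_⟩
    nlinarith [hle β hβ f, hle' β hβ f, sq_nonneg ((f σ - f τ) - (f τ - f η))]

variable {A B : Finset V} {f₀ : V → ℝ}

lemma tendsto_networkCapacity_iSup (hf₀ : f₀ ∈ potentials A B)
    (hcut : ∀ σ η, f₀ σ ≠ f₀ η → Γ ≤ E σ η) :
    Tendsto (fun β => networkCapacity (boltzmann E Γ β) A B) atTop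
      (𝓝 (⨆ β, networkCapacity (lowBoltzmann E Γ β) A B)) := by
  have hne : (potentials A B).Nonempty := ⟨f₀, hf₀⟩
  obtain ⟨ε, hε, hgap⟩ := exists_energy_gap (fun p : V × V => E p.1 p.2) Γ
  have hmono : Monotone fun β => networkCapacity (lowBoltzmann E Γ β) A B := fun β β' hβ =>
    networkCapacity_mono (lowBoltzmann_nonneg β) (lowBoltzmann_mono hβ) hne
  have hbdd : BddAbove (Set.range fun β => networkCapacity (lowBoltzmann E Γ β) A B) := by
    refine ⟨(1 / 2) * ∑ p : V × V with E p.1 p.2 = Γ, (f₀ p.1 - f₀ p.2) ^ 2, ?_⟩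
    rintro _ ⟨β, rfl⟩
    exact dirichletForm_lowBoltzmann_of_cut hcut β ▸ networkCapacity_le (lowBoltzmann_nonneg β) hf₀
  have hlow := tendsto_atTop_ciSup hmono hbdd
  refine tendsto_of_tendsto_of_tendsto_of_le_of_le' hlow ?_
    (Eventually.of_forall fun β =>
      networkCapacity_mono (lowBoltzmann_nonneg β) (lowBoltzmann_le_boltzmann β) hne)
    ((eventually_ge_atTop 0).mono fun β hβ =>
      networkCapacity_le_add (boltzmann_nonneg β) (Real.exp_pos (-β * ε)).le
        (boltzmann_le_lowBoltzmann_add hβ hgap) hne)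
  simpa using hlow.add ((tendsto_exp_neg_mul hε).const_mul ((Fintype.card V : ℝ) ^ 2 / 2))

theorem exists_pos_tendsto_networkCapacity (hf₀ : f₀ ∈ potentials A B)
    (hcut : ∀ σ η, f₀ σ ≠ f₀ η → Γ ≤ E σ η) {a b : V} (ha : a ∈ A) (hb : b ∈ B)
    (hconn : Relation.EqvGen (fun σ η => E σ η ≤ Γ) a b) :
    ∃ k : ℝ, 0 < k ∧ Tendsto (fun β => networkCapacity (boltzmann E Γ β) A B) atTop (𝓝 k) := by
  obtain ⟨c, hc, hle⟩ :=
    exists_sq_sub_le_of_eqvGen (E := E) (Γ := Γ) (ε := 0) (by simpa using hconn)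
  have hlim := tendsto_networkCapacity_iSup hf₀ hcut
  refine ⟨_, (inv_pos.2 hc).trans_le (ge_of_tendsto hlim ?_), hlim⟩
  filter_upwards [eventually_ge_atTop 0] with β hβ
  refine le_networkCapacity ⟨f₀, hf₀⟩ fun f hf => (inv_le_iff_one_le_mul₀' hc).2 ?_
  simpa [hf.2.1 a ha, hf.2.2 b hb] using hle β hβ f

lemma networkCapacity_boltzmann_le (hf₀ : f₀ ∈ potentials A B)
    (hcut : ∀ σ η, f₀ σ ≠ f₀ η → Γ ≤ E σ η) {T : Finset (V × V)}
    (hT : ∀ σ η, f₀ σ ≠ f₀ η → E σ η = Γ → (σ, η) ∈ T) {ε β : ℝ} (hβ : 0 ≤ β)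
    (hgap : ∀ p : V × V, E p.1 p.2 ≠ Γ → ε ≤ |E p.1 p.2 - Γ|) :
    networkCapacity (boltzmann E Γ β) A B ≤
      (T.card : ℝ) / 2 + (Fintype.card V : ℝ) ^ 2 / 2 * Real.exp (-β * ε) := by
  classical
  have hsum : ∑ p : V × V with E p.1 p.2 = Γ, (f₀ p.1 - f₀ p.2) ^ 2 ≤ T.card := by
    calc ∑ p : V × V with E p.1 p.2 = Γ, (f₀ p.1 - f₀ p.2) ^ 2
        ≤ ∑ p : V × V with E p.1 p.2 = Γ, if p ∈ T then (1 : ℝ) else 0 := by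
          refine Finset.sum_le_sum fun p hp => ?_
          by_cases hf : f₀ p.1 = f₀ p.2
          · rw [hf, sub_self, zero_pow two_ne_zero]
            split_ifs <;> norm_num
          · rw [if_pos (hT _ _ hf (Finset.mem_filter.1 hp).2)]
            exact sq_sub_le_one_of_mem_potentials hf₀ _ _
      _ ≤ ∑ p : V × V, if p ∈ T then (1 : ℝ) else 0 :=
          Finset.sum_le_sum_of_subset_of_nonneg (Finset.filter_subset _ _)
            fun _ _ _ => by split_ifs <;> norm_num
      _ = T.card := by simp
  refine (networkCapacity_le (boltzmann_nonneg β) hf₀).trans <|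
    (dirichletForm_le_add (Real.exp_pos _).le (boltzmann_le_lowBoltzmann_add hβ hgap) hf₀).trans ?_
  rw [dirichletForm_lowBoltzmann_of_cut hcut]
  linarith

lemma exists_sq_one_sub_abs_le_of_eqvGen {a b x y : V} {ε : ℝ} (ha : a ∈ A) (hb : b ∈ B)
    (hax : Relation.EqvGen (fun σ η => E σ η ≤ Γ - ε) a x)
    (hby : Relation.EqvGen (fun σ η => E σ η ≤ Γ - ε) b y) :
    ∃ c : ℝ, 0 < c ∧ ∀ β : ℝ, 0 ≤ β → ∀ f ∈ potentials A B,
      (1 - |f x - f y|) ^ 2 ≤ c * Real.exp (-β * ε) * dirichletForm (boltzmann E Γ β) f := by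
  obtain ⟨c, hc, hle⟩ := exists_sq_sub_le_of_eqvGen hax
  obtain ⟨c', hc', hle'⟩ := exists_sq_sub_le_of_eqvGen hby
  refine ⟨2 * (c + c'), by positivity, fun β hβ f hf => ?_⟩
  have hx := hle β hβ f
  have hy := hle' β hβ f
  rw [hf.2.1 a ha] at hx
  rw [hf.2.2 b hb] at hy
  calc (1 - |f x - f y|) ^ 2 ≤ ((1 - f x) - (0 - f y)) ^ 2 := by
        nlinarith [le_abs_self (f x - f y), sq_abs (f x - f y)]
    _ ≤ 2 * (1 - f x) ^ 2 + 2 * (0 - f y) ^ 2 := by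
        nlinarith [sq_nonneg ((1 - f x) + (0 - f y))]
    _ ≤ _ := by linarith

/-- Young's inequality `1 ≤ (1 + s) u ^ 2 + (1 + s⁻¹) (1 - |u|) ^ 2` along each edge, with `s` small
but much larger than the error `s ^ 2` made by treating the two clusters as equipotential. -/
lemma card_le_mul_dirichletForm {T : Finset (V × V)} (hTE : ∀ p ∈ T, E p.1 p.2 = Γ)
    {β s : ℝ} (hs : 0 < s) {f : V → ℝ} {c : V × V → ℝ}
    (hc : ∀ p ∈ T, (1 - |f p.1 - f p.2|) ^ 2 ≤
      c p * s ^ 2 * dirichletForm (boltzmann E Γ β) f) :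
    (T.card : ℝ) ≤
      (2 * (1 + s) + (∑ p ∈ T, c p) * (s ^ 2 + s)) * dirichletForm (boltzmann E Γ β) f := by
  set D := dirichletForm (boltzmann E Γ β) f
  have hT : ∑ p ∈ T, (f p.1 - f p.2) ^ 2 ≤ 2 * D := by
    refine le_trans (Finset.sum_le_sum fun p hp => ?_)
      (sum_mul_sq_sub_le_dirichletForm (boltzmann_nonneg β) T f)
    simp [boltzmann, hTE p hp]
  have hyoung : ∀ u : ℝ, 1 ≤ (1 + s) * u ^ 2 + (1 + s⁻¹) * (1 - |u|) ^ 2 := fun u => by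
    have hsq : (1 + s) * |u| ^ 2 + (1 + s⁻¹) * (1 - |u|) ^ 2 - 1
        = s⁻¹ * (s * |u| - (1 - |u|)) ^ 2 := by field_simp; ring
    have hpos : 0 ≤ s⁻¹ * (s * |u| - (1 - |u|)) ^ 2 := by positivity
    rw [sq_abs] at hsq
    linarith
  calc (T.card : ℝ) = ∑ _p ∈ T, (1 : ℝ) := by simp
    _ ≤ ∑ p ∈ T, ((1 + s) * (f p.1 - f p.2) ^ 2 + (1 + s⁻¹) * (c p * s ^ 2 * D)) :=
        Finset.sum_le_sum fun _ hp => (hyoung _).trans <| by gcongr; exact hc _ hp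
    _ = (1 + s) * ∑ p ∈ T, (f p.1 - f p.2) ^ 2 + (1 + s⁻¹) * ((∑ p ∈ T, c p) * s ^ 2 * D) := by
        rw [Finset.sum_add_distrib, ← Finset.mul_sum, ← Finset.mul_sum, ← Finset.sum_mul,
          ← Finset.sum_mul]
    _ ≤ (1 + s) * (2 * D) + (1 + s⁻¹) * ((∑ p ∈ T, c p) * s ^ 2 * D) := by gcongr
    _ = _ := by field_simp

lemma exists_card_div_le_networkCapacity (hne : (potentials A B).Nonempty)
    {T : Finset (V × V)} (hTE : ∀ p ∈ T, E p.1 p.2 = Γ) {ε : ℝ}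
    (hedge : ∀ p ∈ T, ∃ c : ℝ, 0 < c ∧ ∀ β : ℝ, 0 ≤ β → ∀ f ∈ potentials A B,
      (1 - |f p.1 - f p.2|) ^ 2 ≤ c * Real.exp (-β * ε) * dirichletForm (boltzmann E Γ β) f) :
    ∃ C : ℝ, ∀ β : ℝ, 0 ≤ β → (T.card : ℝ) / (2 * (1 + Real.exp (-β * (ε / 2))) +
      C * (Real.exp (-β * (ε / 2)) ^ 2 + Real.exp (-β * (ε / 2)))) ≤
        networkCapacity (boltzmann E Γ β) A B := by
  choose! c hc hle using hedge
  refine ⟨∑ p ∈ T, c p, fun β hβ => le_networkCapacity hne fun f hf => ?_⟩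
  have hC : 0 ≤ ∑ p ∈ T, c p := Finset.sum_nonneg fun p hp => (hc p hp).le
  rw [div_le_iff₀ (by positivity), mul_comm]
  refine card_le_mul_dirichletForm hTE (Real.exp_pos _) fun p hp => ?_
  have hsq : Real.exp (-β * (ε / 2)) ^ 2 = Real.exp (-β * ε) := by
    rw [← Real.exp_nat_mul]
    ring_nf
  exact hsq ▸ hle p hp β hβ f hf

theorem tendsto_networkCapacity_card_div_two (hf₀ : f₀ ∈ potentials A B)
    (hcut : ∀ σ η, f₀ σ ≠ f₀ η → Γ ≤ E σ η) {T : Finset (V × V)}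
    (hT : ∀ σ η, f₀ σ ≠ f₀ η → E σ η = Γ → (σ, η) ∈ T) (hTE : ∀ p ∈ T, E p.1 p.2 = Γ)
    {a b : V} (ha : a ∈ A) (hb : b ∈ B)
    (hconn : ∀ p ∈ T,
      (Relation.EqvGen (fun σ η => E σ η < Γ) a p.1 ∧
        Relation.EqvGen (fun σ η => E σ η < Γ) b p.2) ∨
      (Relation.EqvGen (fun σ η => E σ η < Γ) a p.2 ∧
        Relation.EqvGen (fun σ η => E σ η < Γ) b p.1)) :
    Tendsto (fun β => networkCapacity (boltzmann E Γ β) A B) atTop (𝓝 ((T.card : ℝ) / 2)) := by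
  obtain ⟨ε, hε, hgap⟩ := exists_energy_gap (fun p : V × V => E p.1 p.2) Γ
  have hbelow : ∀ {x y : V}, Relation.EqvGen (fun σ η => E σ η < Γ) x y →
      Relation.EqvGen (fun σ η => E σ η ≤ Γ - ε) x y := fun hxy => hxy.mono fun σ η hlt => by
    have := hgap (σ, η) hlt.ne
    rw [abs_of_neg (sub_neg.2 hlt)] at this
    linarith
  obtain ⟨C, hC⟩ := exists_card_div_le_networkCapacity ⟨f₀, hf₀⟩ hTE (ε := ε) fun p hp => by
    rcases hconn p hp with ⟨hA, hB⟩ | ⟨hA, hB⟩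
    · exact exists_sq_one_sub_abs_le_of_eqvGen ha hb (hbelow hA) (hbelow hB)
    · simpa only [abs_sub_comm] using
        exists_sq_one_sub_abs_le_of_eqvGen ha hb (hbelow hA) (hbelow hB)
  refine tendsto_of_tendsto_of_tendsto_of_le_of_le' ?_ ?_ ((eventually_ge_atTop 0).mono hC)
    ((eventually_ge_atTop 0).mono fun β hβ => networkCapacity_boltzmann_le hf₀ hcut hT hβ hgap)
  · have hs := tendsto_exp_neg_mul (half_pos hε)
    refine tendsto_const_nhds.div ?_ two_ne_zero
    simpa using ((hs.const_add 1).const_mul 2).add (((hs.pow 2).add hs).const_mul C)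
  · simpa using ((tendsto_exp_neg_mul hε).const_mul ((Fintype.card V : ℝ) ^ 2 / 2)).const_add
      ((T.card : ℝ) / 2)

end LowTemperature

section Cycle

variable {L : ℕ}

/-- The number of bonds of the cycle `ZMod L` with both endpoints in `T`. -/
def innerBonds (T : Finset (ZMod L)) : ℕ := (T.filter fun y => y + 1 ∈ T).card

/-- The number of neighbours of `y` in a subset `T` of the cycle. -/
def cycleDegree (T : Finset (ZMod L)) (y : ZMod L) : ℕ :=
  (if y + 1 ∈ T then 1 else 0) + (if y - 1 ∈ T then 1 else 0)

lemma innerBonds_insert (hL : 1 < L) {T : Finset (ZMod L)} {y : ZMod L} (hy : y ∉ T) :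
    innerBonds (insert y T) = innerBonds T + cycleDegree T y := by
  have : Fact (1 < L) := ⟨hL⟩
  have hpred : (T.filter fun x => x + 1 = y ∨ x + 1 ∈ T).card =
      (if y - 1 ∈ T then 1 else 0) + innerBonds T := by
    have hsingle : (T.filter fun x => x + 1 = y).card = if y - 1 ∈ T then 1 else 0 := by
      simp only [← eq_sub_iff_add_eq, Finset.filter_eq']
      split_ifs <;> rfl
    rw [Finset.filter_or, Finset.card_union_of_disjoint, hsingle, innerBonds]
    exact Finset.disjoint_filter.2 fun x _ hx hxT => hy (hx ▸ hxT)
  have hfilter : innerBonds (insert y T) =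
      (if y + 1 ∈ T then 1 else 0) + (T.filter fun x => x + 1 = y ∨ x + 1 ∈ T).card := by
    rw [innerBonds, Finset.filter_insert]
    simp only [Finset.mem_insert, add_eq_left, one_ne_zero, false_or]
    split_ifs
    · rw [Finset.card_insert_of_notMem (by simp [hy]), add_comm]
    · rw [zero_add]
  rw [hfilter, hpred, cycleDegree]
  omega

variable [NeZero L]

/-- The number of bonds of the cycle between `T` and its complement. -/
def cycleBoundary (T : Finset (ZMod L)) : ℕ :=
  (Finset.univ.filter fun y => ¬ (y ∈ T ↔ y + 1 ∈ T)).card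

@[simp] lemma cycleBoundary_empty : cycleBoundary (∅ : Finset (ZMod L)) = 0 := by
  simp [cycleBoundary]

@[simp] lemma cycleBoundary_univ : cycleBoundary (Finset.univ : Finset (ZMod L)) = 0 := by
  simp [cycleBoundary]

lemma cycleBoundary_add_innerBonds (T : Finset (ZMod L)) :
    cycleBoundary T + 2 * innerBonds T = 2 * T.card := by
  have hcard : ∑ y : ZMod L, (if y ∈ T then 1 else 0) = T.card := by simp
  have hshift : ∑ y : ZMod L, (if y + 1 ∈ T then 1 else 0) = T.card := by
    rw [← hcard]
    exact Equiv.sum_comp (Equiv.addRight (1 : ZMod L)) fun y => if y ∈ T then 1 else 0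
  have hinner : innerBonds T = ∑ y : ZMod L, if y ∈ T ∧ y + 1 ∈ T then 1 else 0 := by
    rw [innerBonds, ← Finset.card_filter, Finset.filter_and, Finset.filter_mem_eq_inter,
      Finset.univ_inter, Finset.inter_filter, Finset.inter_univ]
  rw [two_mul T.card]
  nth_rewrite 1 [← hcard]
  rw [← hshift, hinner, cycleBoundary, Finset.card_filter, Finset.mul_sum,
    ← Finset.sum_add_distrib, ← Finset.sum_add_distrib]
  refine Finset.sum_congr rfl fun y _ => ?_
  by_cases hy : y ∈ T <;> by_cases hy' : y + 1 ∈ T <;> simp [hy, hy']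

lemma cycleBoundary_insert (hL : 1 < L) {T : Finset (ZMod L)} {y : ZMod L} (hy : y ∉ T) :
    cycleBoundary (insert y T) + 2 * cycleDegree T y = cycleBoundary T + 2 := by
  have hT := cycleBoundary_add_innerBonds T
  have hins := cycleBoundary_add_innerBonds (insert y T)
  rw [innerBonds_insert hL hy, Finset.card_insert_of_notMem hy] at hins
  omega

lemma forall_mem_of_add_one_mem {T : Finset (ZMod L)} {y : ZMod L} (hy : y ∈ T)
    (hsucc : ∀ x ∈ T, x + 1 ∈ T) (x : ZMod L) : x ∈ T := by
  have hmem : ∀ n : ℕ, y + n ∈ T := fun n => by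
    induction n with
    | zero => simpa using hy
    | succ n ih => simpa [add_assoc] using hsucc _ ih
  simpa using hmem (x - y).val

lemma exists_exit {T : Finset (ZMod L)} (hne : T.Nonempty) (hu : T ≠ Finset.univ) :
    ∃ y ∈ T, y + 1 ∉ T := by
  by_contra! hsucc
  obtain ⟨y, hy⟩ := hne
  exact hu (Finset.eq_univ_iff_forall.2 (forall_mem_of_add_one_mem hy hsucc))

lemma exists_entry {T : Finset (ZMod L)} (hne : T.Nonempty) (hu : T ≠ Finset.univ) :
    ∃ y ∉ T, y + 1 ∈ T := by
  obtain ⟨y, hy, hy'⟩ := exists_exit (T := Tᶜ)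
    (by rwa [Finset.nonempty_iff_ne_empty, Ne, Finset.compl_eq_empty_iff])
    (by rwa [Ne, Finset.compl_eq_univ_iff, ← Ne, ← Finset.nonempty_iff_ne_empty])
  exact ⟨y, by simpa using hy, by simpa using hy'⟩

lemma two_le_cycleBoundary {T : Finset (ZMod L)} (hne : T.Nonempty) (hu : T ≠ Finset.univ) :
    2 ≤ cycleBoundary T := by
  obtain ⟨y, hy, hy'⟩ := exists_exit hne hu
  obtain ⟨z, hz, hz'⟩ := exists_entry hne hu
  exact Finset.one_lt_card.2
    ⟨y, by simp [hy, hy'], z, by simp [hz, hz'], by rintro rfl; exact hz hy⟩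

end Cycle

/-! ### Isoperimetry on the torus -/

section Transpose

variable {L : ℕ}

/-- The nonempty columns of `s`. -/
def columnSupport (s : Finset (Torus L)) : Finset (ZMod L) := s.image Prod.fst

/-- The nonempty rows of `s`. -/
def rowSupport (s : Finset (Torus L)) : Finset (ZMod L) := s.image Prod.snd

lemma subset_columnSupport_product_rowSupport (s : Finset (Torus L)) :
    s ⊆ columnSupport s ×ˢ rowSupport s := fun _ hx =>
  Finset.mem_product.2 ⟨Finset.mem_image_of_mem _ hx, Finset.mem_image_of_mem _ hx⟩

lemma card_le_card_columnSupport_mul_card_rowSupport (s : Finset (Torus L)) :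
    s.card ≤ (columnSupport s).card * (rowSupport s).card := by
  simpa only [Finset.card_product] using
    Finset.card_le_card (subset_columnSupport_product_rowSupport s)

/-- The reflection of a subset of the torus in the diagonal, which exchanges columns and rows. -/
def transpose (s : Finset (Torus L)) : Finset (Torus L) := s.map (Equiv.prodComm _ _).toEmbedding

@[simp] lemma mem_transpose {s : Finset (Torus L)} {x : Torus L} :
    x ∈ transpose s ↔ x.swap ∈ s := by
  simp only [transpose, Finset.mem_map_equiv]
  rfl

@[simp] lemma transpose_transpose (s : Finset (Torus L)) : transpose (transpose s) = s := by
  ext x; simp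

@[simp] lemma card_transpose (s : Finset (Torus L)) : (transpose s).card = s.card := by
  simp [transpose]

lemma transpose_insert (s : Finset (Torus L)) (z : Torus L) :
    transpose (insert z s) = insert z.swap (transpose s) := by
  ext x
  simp [Prod.ext_iff, and_comm]

lemma transpose_product (C D : Finset (ZMod L)) : transpose (C ×ˢ D) = D ×ˢ C := by
  ext ⟨x, y⟩
  simp [and_comm]

@[simp] lemma columnSupport_transpose (s : Finset (Torus L)) :
    columnSupport (transpose s) = rowSupport s := by
  ext; simp [columnSupport, rowSupport]

@[simp] lemma rowSupport_transpose (s : Finset (Torus L)) :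
    rowSupport (transpose s) = columnSupport s := by
  ext; simp [columnSupport, rowSupport]

end Transpose

section Isoperimetry

variable {L : ℕ} [NeZero L]

/-- The section of `s` over the first coordinate `c`. -/
def column (s : Finset (Torus L)) (c : ZMod L) : Finset (ZMod L) :=
  Finset.univ.filter fun y => (c, y) ∈ s

/-- The section of `s` over the second coordinate `r`. -/
def row (s : Finset (Torus L)) (r : ZMod L) : Finset (ZMod L) :=
  Finset.univ.filter fun x => (x, r) ∈ s

/-- The number of bonds of the torus between `s` and its complement. -/
def perimeter (s : Finset (Torus L)) : ℕ :=
  ∑ c, cycleBoundary (column s c) + ∑ r, cycleBoundary (row s r)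

/-- The number of nearest neighbours of `z` in `s`. -/
def neighborCount (s : Finset (Torus L)) (z : Torus L) : ℕ :=
  cycleDegree (column s z.1) z.2 + cycleDegree (row s z.2) z.1

/-- The energy, relative to the configuration without pluses, of the configuration with set of
pluses `s` in the nearest-neighbour Ising model with coupling and field equal to `1` and `h`. -/
def excess (h : ℝ) (s : Finset (Torus L)) : ℝ := 2 * perimeter s - 2 * h * s.card

@[simp] lemma mem_column {s : Finset (Torus L)} {c y : ZMod L} : y ∈ column s c ↔ (c, y) ∈ s := by
  simp [column]

@[simp] lemma mem_row {s : Finset (Torus L)} {r x : ZMod L} : x ∈ row s r ↔ (x, r) ∈ s := by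
  simp [row]

@[simp] lemma column_empty (c : ZMod L) : column (∅ : Finset (Torus L)) c = ∅ := by ext; simp

@[simp] lemma row_empty (r : ZMod L) : row (∅ : Finset (Torus L)) r = ∅ := by ext; simp

@[simp] lemma column_univ (c : ZMod L) :
    column (Finset.univ : Finset (Torus L)) c = Finset.univ := by
  ext; simp

@[simp] lemma row_univ (r : ZMod L) : row (Finset.univ : Finset (Torus L)) r = Finset.univ := by
  ext; simp

@[simp] lemma column_transpose (s : Finset (Torus L)) (c : ZMod L) :
    column (transpose s) c = row s c := by
  ext; simp

@[simp] lemma row_transpose (s : Finset (Torus L)) (r : ZMod L) :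
    row (transpose s) r = column s r := by
  ext; simp

lemma column_insert (s : Finset (Torus L)) (z : Torus L) (c : ZMod L) :
    column (insert z s) c = if c = z.1 then insert z.2 (column s c) else column s c := by
  ext y
  split_ifs with hc <;> simp [Prod.ext_iff, hc]

@[simp] lemma perimeter_transpose (s : Finset (Torus L)) :
    perimeter (transpose s) = perimeter s := by
  simp [perimeter, add_comm]

@[simp] lemma excess_transpose (h : ℝ) (s : Finset (Torus L)) :
    excess h (transpose s) = excess h s := by
  simp [excess]

lemma sum_cycleBoundary_column_insert (hL : 1 < L) {s : Finset (Torus L)} {z : Torus L}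
    (hz : z ∉ s) : ∑ c, cycleBoundary (column (insert z s) c) + 2 * cycleDegree (column s z.1) z.2 =
      ∑ c, cycleBoundary (column s c) + 2 := by
  have hcol : cycleBoundary (column (insert z s) z.1) + 2 * cycleDegree (column s z.1) z.2 =
      cycleBoundary (column s z.1) + 2 := by
    rw [column_insert, if_pos rfl]
    exact cycleBoundary_insert hL (by simpa using hz)
  have hrest : ∑ c ∈ Finset.univ.erase z.1, cycleBoundary (column (insert z s) c) =
      ∑ c ∈ Finset.univ.erase z.1, cycleBoundary (column s c) :=
    Finset.sum_congr rfl fun c hc => by rw [column_insert, if_neg (Finset.ne_of_mem_erase hc)]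
  rw [← Finset.add_sum_erase _ _ (Finset.mem_univ z.1),
    ← Finset.add_sum_erase _ (fun c => cycleBoundary (column s c)) (Finset.mem_univ z.1)]
  lia



lemma perimeter_insert (hL : 1 < L) {s : Finset (Torus L)} {z : Torus L} (hz : z ∉ s) :
    perimeter (insert z s) + 2 * neighborCount s z = perimeter s + 4 := by
  have hcol := sum_cycleBoundary_column_insert hL hz
  have hrow :=
    sum_cycleBoundary_column_insert (s := transpose s) (z := z.swap) hL (by simpa using hz)
  simp only [← transpose_insert, column_transpose, Prod.fst_swap, Prod.snd_swap] at hrow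
  unfold perimeter neighborCount
  omega

lemma excess_insert (hL : 1 < L) (h : ℝ) {s : Finset (Torus L)} {z : Torus L} (hz : z ∉ s) :
    excess h (insert z s) = excess h s + 8 - 4 * neighborCount s z - 2 * h := by
  have hperim : (perimeter (insert z s) : ℝ) + 2 * neighborCount s z = perimeter s + 4 := by
    exact_mod_cast perimeter_insert hL hz
  unfold excess
  rw [Finset.card_insert_of_notMem hz]
  push_cast
  linarith

@[simp] lemma excess_empty (h : ℝ) : excess h (∅ : Finset (Torus L)) = 0 := by
  simp [excess, perimeter]

lemma card_torus : (Finset.univ : Finset (Torus L)).card = L ^ 2 := by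
  simp [Finset.card_univ, ZMod.card, sq]

lemma excess_univ (h : ℝ) : excess h (Finset.univ : Finset (Torus L)) = -2 * h * (L : ℝ) ^ 2 := by
  simp [excess, perimeter, card_torus, -Finset.card_univ]

lemma eq_univ_of_excess_le {h : ℝ} (h_pos : 0 < h) {s : Finset (Torus L)}
    (hs : excess h s ≤ excess h (Finset.univ : Finset (Torus L))) : s = Finset.univ := by
  rw [excess_univ, excess] at hs
  have hcard : (L ^ 2 : ℝ) ≤ s.card := by
    by_contra! hlt
    nlinarith [(perimeter s).cast_nonneg (α := ℝ)]
  refine Finset.eq_of_subset_of_card_le s.subset_univ ?_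
  rw [card_torus]
  exact_mod_cast hcard

lemma column_nonempty {s : Finset (Torus L)} {c : ZMod L} (hc : c ∈ columnSupport s) :
    (column s c).Nonempty := by
  obtain ⟨x, hx, rfl⟩ := Finset.mem_image.1 hc
  exact ⟨x.2, by simpa using hx⟩

/-- The columns entirely contained in `s`. -/
def fullColumns (s : Finset (Torus L)) : Finset (ZMod L) :=
  Finset.univ.filter fun c => column s c = Finset.univ

@[simp] lemma mem_fullColumns {s : Finset (Torus L)} {c : ZMod L} :
    c ∈ fullColumns s ↔ ∀ y, (c, y) ∈ s := by
  simp [fullColumns, Finset.eq_univ_iff_forall]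

lemma fullColumns_subset_columnSupport (s : Finset (Torus L)) :
    fullColumns s ⊆ columnSupport s := fun c hc =>
  Finset.mem_image.2 ⟨(c, 0), mem_fullColumns.1 hc 0, rfl⟩

lemma two_mul_card_columnSupport_le (s : Finset (Torus L)) :
    2 * (columnSupport s).card ≤
      ∑ c, cycleBoundary (column s c) + 2 * (fullColumns s).card := by
  have hpartial : (columnSupport s \ fullColumns s).card * 2 ≤ ∑ c, cycleBoundary (column s c) :=
    calc (columnSupport s \ fullColumns s).card * 2
        ≤ ∑ c ∈ columnSupport s \ fullColumns s, cycleBoundary (column s c) :=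
          (smul_eq_mul (columnSupport s \ fullColumns s).card 2).symm.trans_le <|
            Finset.card_nsmul_le_sum _ _ _ fun c hc => by
            rw [Finset.mem_sdiff] at hc
            exact two_le_cycleBoundary (column_nonempty hc.1) (by simpa [fullColumns] using hc.2)
      _ ≤ ∑ c, cycleBoundary (column s c) := Finset.sum_le_sum_of_subset (Finset.subset_univ _)
  have hcard := Finset.card_sdiff_add_card_eq_card (fullColumns_subset_columnSupport s)
  omega

lemma two_mul_card_fullColumns_le {l : ℕ} (hl : 2 * l < L) {s : Finset (Torus L)}
    (hs : s.card ≤ l ^ 2) : 2 * (fullColumns s).card ≤ l := by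
  have hsub : fullColumns s ×ˢ (Finset.univ : Finset (ZMod L)) ⊆ s := fun x hx =>
    mem_fullColumns.1 (Finset.mem_product.1 hx).1 x.2
  have hmul : (fullColumns s).card * L ≤ s.card := by
    simpa [Finset.card_product, ZMod.card] using Finset.card_le_card hsub
  by_contra! hlt
  nlinarith

lemma card_rowSupport_of_fullColumns_nonempty {s : Finset (Torus L)}
    (hs : (fullColumns s).Nonempty) : (rowSupport s).card = L := by
  obtain ⟨c, hc⟩ := hs
  have huniv : rowSupport s = Finset.univ := Finset.eq_univ_iff_forall.2 fun r =>
    Finset.mem_image.2 ⟨(c, r), mem_fullColumns.1 hc r, rfl⟩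
  rw [huniv, Finset.card_univ, ZMod.card]

/-- The first alternative accounts for the sets that wind around the torus. -/
lemma isoperimetric {l : ℕ} (hl : 2 * l < L) {s : Finset (Torus L)} (hs : s.card ≤ l ^ 2) :
    4 * l + 2 ≤ perimeter s ∨
      2 * ((columnSupport s).card + (rowSupport s).card) ≤ perimeter s := by
  have hcol := two_mul_card_columnSupport_le s
  have hrow := two_mul_card_columnSupport_le (transpose s)
  have hfull := two_mul_card_fullColumns_le hl hs
  have hfull' := two_mul_card_fullColumns_le hl (s := transpose s) (by simpa using hs)
  have hwind : (fullColumns s).card = 0 ∨ (rowSupport s).card = L :=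
    (Finset.eq_empty_or_nonempty _).imp Finset.card_eq_zero.2
      card_rowSupport_of_fullColumns_nonempty
  have hwind' : (fullColumns (transpose s)).card = 0 ∨ (columnSupport s).card = L :=
    (Finset.eq_empty_or_nonempty _).imp Finset.card_eq_zero.2 fun hne =>
      rowSupport_transpose s ▸ card_rowSupport_of_fullColumns_nonempty hne
  simp only [columnSupport_transpose, column_transpose] at hrow
  unfold perimeter
  omega

end Isoperimetry

/-! ### Arcs and quasi-squares -/

section Arithmetic

lemma mul_le_of_add_le {m p q : ℕ} (hsum : p + q ≤ 2 * m + 1) : p * q ≤ m * (m + 1) := by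
  have hp : p * (p + q) ≤ p * (2 * m + 1) := Nat.mul_le_mul_left p hsum
  rcases le_or_gt p m with hpm | hpm <;> obtain ⟨k, rfl⟩ := Nat.exists_eq_add_of_le hpm <;>
    nlinarith

lemma le_of_add_le_of_le_mul {m p q : ℕ} (hsum : p + q ≤ 2 * m + 1)
    (hprod : m * (m + 1) ≤ p * q) : m ≤ p := by
  by_contra! hpm
  have hp : p * (p + q) ≤ p * (2 * m + 1) := Nat.mul_le_mul_left p hsum
  obtain ⟨k, rfl⟩ := Nat.exists_eq_add_of_lt hpm
  nlinarith

lemma eq_or_eq_of_add_le_of_le_mul {m p q : ℕ} (hm : 0 < m) (hsum : p + q ≤ 2 * m + 1)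
    (hprod : m * (m + 1) ≤ p * q) : (p = m ∧ q = m + 1) ∨ (p = m + 1 ∧ q = m) := by
  have hp := le_of_add_le_of_le_mul hsum hprod
  have hq := le_of_add_le_of_le_mul (add_comm p q ▸ hsum) (mul_comm p q ▸ hprod)
  have hne : ¬ (p = m ∧ q = m) := by
    rintro ⟨rfl, rfl⟩
    nlinarith
  omega

end Arithmetic

section Arcs

variable {L : ℕ} [NeZero L]

lemma val_add_one_eq (x : ZMod L) : (x + 1).val = if x.val + 1 = L then 0 else x.val + 1 := by
  rw [← ZMod.natCast_zmod_val x, ← Nat.cast_add_one, ZMod.val_natCast, ZMod.natCast_zmod_val]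
  split_ifs with hx
  · rw [hx, Nat.mod_self]
  · exact Nat.mod_eq_of_lt (lt_of_le_of_ne (ZMod.val_lt x) hx)

lemma val_sub_eq (x u : ZMod L) :
    (x - u).val = if (x - (u + 1)).val + 1 = L then 0 else (x - (u + 1)).val + 1 := by
  rw [← val_add_one_eq]
  congr 1
  ring

lemma eq_add_natCast_iff {n : ℕ} (hn : n < L) {x u : ZMod L} : x = u + n ↔ (x - u).val = n := by
  rw [← sub_eq_iff_eq_add', ← (ZMod.val_injective L).eq_iff, ZMod.val_natCast_of_lt hn]

/-- The arc of the cycle of length `a` starting at `u`. -/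
def arc (u : ZMod L) (a : ℕ) : Finset (ZMod L) := Finset.univ.filter fun x => (x - u).val < a

@[simp] lemma mem_arc {u x : ZMod L} {a : ℕ} : x ∈ arc u a ↔ (x - u).val < a := by simp [arc]

lemma card_arc (u : ZMod L) {a : ℕ} (ha : a ≤ L) : (arc u a).card = a := by
  have himage : (arc u a).image (fun x => (x - u).val) = Finset.range a := by
    ext i
    simp only [Finset.mem_image, mem_arc, Finset.mem_range]
    refine ⟨by rintro ⟨x, hx, rfl⟩; exact hx, fun hi => ⟨u + i, ?_⟩⟩
    rw [add_sub_cancel_left, ZMod.val_natCast_of_lt (hi.trans_le ha)]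
    exact ⟨hi, rfl⟩
  rw [← Finset.card_image_of_injective (arc u a)
    ((ZMod.val_injective L).comp (sub_left_injective (b := u)))]
  exact (congrArg Finset.card himage).trans (Finset.card_range a)

lemma arc_subset_of_forall_sub_one_mem {T : Finset (ZMod L)} {u : ZMod L}
    (hT : ∀ x ∈ T, x ≠ u → x - 1 ∈ T) {x : ZMod L} (hx : x ∈ T) :
    arc u ((x - u).val + 1) ⊆ T := by
  have hdown : ∀ n < L, u + (n : ZMod L) ∈ T → ∀ i ≤ n, u + (i : ZMod L) ∈ T := by
    intro n
    induction n with
    | zero => simp +contextual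
    | succ n ih =>
      intro hn hmem i hi
      have hne : u + ((n + 1 : ℕ) : ZMod L) ≠ u := fun heq => by
        simpa using (eq_add_natCast_iff hn).1 heq.symm
      rcases hi.eq_or_lt with rfl | hi
      · exact hmem
      · refine ih (by omega) ?_ i (by omega)
        simpa [← add_assoc] using hT _ hmem hne
  intro y hy
  have hyT := hdown (x - u).val (ZMod.val_lt _) (by simpa using hx) (y - u).val
    (Nat.lt_succ_iff.1 (mem_arc.1 hy))
  simpa using hyT

lemma eq_arc_of_forall_sub_one_mem {T : Finset (ZMod L)} {u : ZMod L}
    (hT : ∀ x ∈ T, x ≠ u → x - 1 ∈ T) : T = arc u T.card := by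
  have hcard : T.card ≤ L := by simpa [ZMod.card] using Finset.card_le_univ T
  refine Finset.eq_of_subset_of_card_le (fun x hx => mem_arc.2 ?_) (card_arc u hcard).le
  have hle := Finset.card_le_card (arc_subset_of_forall_sub_one_mem hT hx)
  rwa [card_arc u (ZMod.val_lt (x - u)), Nat.succ_le_iff] at hle

lemma exists_eq_arc {T : Finset (ZMod L)} (hne : T.Nonempty) (hu : T ≠ Finset.univ)
    (hT : cycleBoundary T ≤ 2) : ∃ u, T = arc u T.card := by
  obtain ⟨e, he, he'⟩ := exists_entry hne hu
  obtain ⟨y, hy, hy'⟩ := exists_exit hne hu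
  refine ⟨e + 1, eq_arc_of_forall_sub_one_mem fun x hx hxe => ?_⟩
  by_contra hpred
  refine hT.not_gt <| Finset.two_lt_card.2 ⟨e, by simp [he, he'], x - 1, by simp [hx, hpred],
    y, by simp [hy, hy'], ?_, ?_, ?_⟩
  · rintro rfl
    exact hxe (sub_add_cancel x 1).symm
  · rintro rfl
    exact he hy
  · rintro rfl
    exact hpred hy

lemma eq_of_add_one_mem_arc {u p : ZMod L} {a : ℕ} (hmem : p + 1 ∈ arc u a) (hp : p ∉ arc u a) :
    u = p + 1 := by
  rw [mem_arc, ← sub_add_eq_add_sub, val_add_one_eq] at hmem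
  rw [mem_arc] at hp
  have hlast : (p - u).val + 1 = L := by
    by_contra hlast
    rw [if_neg hlast] at hmem
    omega
  have hzero := val_add_one_eq (p - u)
  rw [if_pos hlast, ZMod.val_eq_zero, sub_add_eq_add_sub, sub_eq_zero] at hzero
  exact hzero.symm

lemma eq_of_sub_one_mem_arc {u p : ZMod L} {a : ℕ} (hmem : p - 1 ∈ arc u a) (hp : p ∉ arc u a) :
    p = u + a := by
  have hval := val_add_one_eq (p - 1 - u)
  rw [sub_right_comm, sub_add_cancel] at hval
  rw [mem_arc, sub_right_comm] at hmem
  rw [mem_arc] at hp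
  split_ifs at hval
  · omega
  · rw [show a = (p - u).val by omega, ZMod.natCast_zmod_val, add_sub_cancel]

end Arcs

section QuasiSquares

variable {L : ℕ} [NeZero L]

lemma perimeter_product (C D : Finset (ZMod L)) :
    perimeter (C ×ˢ D) = C.card * cycleBoundary D + D.card * cycleBoundary C := by
  have hcol : ∀ c, column (C ×ˢ D) c = if c ∈ C then D else ∅ := fun c => by
    ext; split_ifs with hc <;> simp [hc]
  have hrow : ∀ r, row (C ×ˢ D) r = if r ∈ D then C else ∅ := fun r => by
    ext; split_ifs with hr <;> simp [hr]
  simp [perimeter, hcol, hrow, apply_ite cycleBoundary]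

lemma ne_univ_of_card_lt {T : Finset (ZMod L)} (hT : T.card < L) : T ≠ Finset.univ := by
  rintro rfl
  simp [ZMod.card] at hT

lemma exists_eq_arc_of_perimeter_product_lt {C D : Finset (ZMod L)} (hC : C.Nonempty)
    (hC' : C.card < L) (hD : D.Nonempty) (hD' : D.card < L)
    (hP : perimeter (C ×ˢ D) < 2 * C.card + 3 * D.card) : ∃ u, C = arc u C.card := by
  refine exists_eq_arc hC (ne_univ_of_card_lt hC') ?_
  by_contra! hlt
  have hcol : C.card * 2 ≤ C.card * cycleBoundary D :=
    Nat.mul_le_mul_left _ (two_le_cycleBoundary hD (ne_univ_of_card_lt hD'))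
  have hrow : D.card * 3 ≤ D.card * cycleBoundary C := Nat.mul_le_mul_left _ hlt
  rw [perimeter_product] at hP
  omega



lemma exists_eq_arc_product {C D : Finset (ZMod L)} (hC : C.Nonempty) (hC' : C.card < L)
    (hD : D.Nonempty) (hD' : D.card < L)
    (hP : perimeter (C ×ˢ D) < 2 * (C.card + D.card) + min C.card D.card) :
    ∃ u v, C ×ˢ D = arc u C.card ×ˢ arc v D.card := by
  obtain ⟨u, hu⟩ := exists_eq_arc_of_perimeter_product_lt hC hC' hD hD' (by omega)
  obtain ⟨v, hv⟩ := exists_eq_arc_of_perimeter_product_lt hD hD' hC hC' <| by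
    rw [← transpose_product, perimeter_transpose]
    omega
  exact ⟨u, v, by rw [← hu, ← hv]⟩

lemma exists_eq_arc_product_of_perimeter_lt {m : ℕ} (hm : 2 ≤ m) (hL : 2 * (m + 1) < L)
    {s : Finset (Torus L)} (hs : s.card = m * (m + 1)) (hP : perimeter s < 4 * (m + 1)) :
    ∃ u v, s = arc u m ×ˢ arc v (m + 1) ∨ s = arc u (m + 1) ×ˢ arc v m := by
  have hbox : 2 * ((columnSupport s).card + (rowSupport s).card) ≤ perimeter s :=
    (isoperimetric hL (s := s) (by rw [hs]; nlinarith)).resolve_left (by omega)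
  have hle := card_le_card_columnSupport_mul_card_rowSupport s
  have hsides := eq_or_eq_of_add_le_of_le_mul (by omega) (by omega) (hs ▸ hle)
  have heq : s = columnSupport s ×ˢ rowSupport s := by
    refine Finset.eq_of_subset_of_card_le (subset_columnSupport_product_rowSupport s) ?_
    rw [Finset.card_product, hs]
    rcases hsides with ⟨hp, hq⟩ | ⟨hp, hq⟩ <;> rw [hp, hq]
    rw [mul_comm]
  obtain ⟨u, v, huv⟩ := exists_eq_arc_product (C := columnSupport s) (D := rowSupport s)
    (Finset.card_pos.1 (by omega)) (by omega) (Finset.card_pos.1 (by omega)) (by omega)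
    (by rw [← heq]; omega)
  rw [← heq] at huv
  refine ⟨u, v, hsides.imp ?_ ?_⟩ <;> rintro ⟨hp, hq⟩ <;> rwa [hp, hq] at huv

lemma le_perimeter_of_card {m : ℕ} (hL : 2 * (m + 1) < L) {s : Finset (Torus L)}
    (hlt : m * (m + 1) < s.card) (hle : s.card ≤ (m + 1) ^ 2) : 4 * (m + 1) ≤ perimeter s := by
  rcases isoperimetric hL hle with hwind | hbox
  · omega
  · have hcard := card_le_card_columnSupport_mul_card_rowSupport s
    by_contra! hP
    exact (hlt.trans_le hcard).not_ge (mul_le_of_add_le (by omega))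

end QuasiSquares

/-! ### Critical droplets and subcritical sets -/

section Droplets

variable {L : ℕ} [NeZero L]

/-- The `(m + 1) × (m + 1)` square at `(u, v)`, one of whose vertical sides (the left one if `e`)
is reduced to its `j`-th site: a quasi-square with a protuberance on a longer side. -/
def droplet (m : ℕ) (u v : ZMod L) (e : Bool) (j : ℕ) : Finset (Torus L) :=
  Finset.univ.filter fun x => (x.1 - u).val < m + 1 ∧ (x.2 - v).val < m + 1 ∧
    ((x.1 - u).val = (if e then 0 else m) → (x.2 - v).val = j)

/-- The droplets with position `p.1`, on either side and at either place of the protuberance, in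
the orientation of `droplet` or, if the first Boolean is `true`, reflected in the diagonal. -/
def critDroplet (m : ℕ) (p : (Torus L) × Bool × Bool × Fin (m + 1)) : Finset (Torus L) :=
  if p.2.1 then transpose (droplet m p.1.2 p.1.1 p.2.2.1 p.2.2.2)
  else droplet m p.1.1 p.1.2 p.2.2.1 p.2.2.2

/-- The set of critical droplets. -/
def critDroplets (L : ℕ) [NeZero L] (m : ℕ) : Finset (Finset (Torus L)) :=
  Finset.univ.image (critDroplet m)

lemma droplet_mem_critDroplets {m : ℕ} (u v : ZMod L) (e : Bool) {j : ℕ} (hj : j < m + 1) :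
    droplet m u v e j ∈ critDroplets L m :=
  Finset.mem_image.2 ⟨((u, v), false, e, ⟨j, hj⟩), Finset.mem_univ _, by simp [critDroplet]⟩

lemma transpose_mem_critDroplets {m : ℕ} {s : Finset (Torus L)} (hs : s ∈ critDroplets L m) :
    transpose s ∈ critDroplets L m := by
  obtain ⟨⟨⟨u, v⟩, o, e, j⟩, -, rfl⟩ := Finset.mem_image.1 hs
  refine Finset.mem_image.2 ⟨((v, u), !o, e, j), Finset.mem_univ _, ?_⟩
  cases o <;> simp [critDroplet]

lemma mem_critDroplets_iff {m : ℕ} {s : Finset (Torus L)} : s ∈ critDroplets L m ↔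
    ∃ u v e j, j < m + 1 ∧ (s = droplet m u v e j ∨ s = transpose (droplet m u v e j)) := by
  constructor
  · intro hs
    obtain ⟨⟨⟨u, v⟩, o, e, j⟩, -, rfl⟩ := Finset.mem_image.1 hs
    cases o
    · exact ⟨u, v, e, j, j.2, Or.inl (by simp [critDroplet])⟩
    · exact ⟨v, u, e, j, j.2, Or.inr (by simp [critDroplet])⟩
  · rintro ⟨u, v, e, j, hj, rfl | rfl⟩
    · exact droplet_mem_critDroplets u v e hj
    · exact transpose_mem_critDroplets (droplet_mem_critDroplets u v e hj)

lemma droplet_right {m j : ℕ} (hm : m < L) (hjL : j < L) (hj : j < m + 1) (u v : ZMod L) :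
    droplet m u v false j = insert (u + (m : ZMod L), v + (j : ZMod L))
      (arc u m ×ˢ arc v (m + 1)) := by
  ext ⟨x, y⟩
  simp only [droplet, Finset.mem_filter, Finset.mem_univ, true_and, Finset.mem_insert,
    Finset.mem_product, mem_arc, Prod.mk.injEq, eq_add_natCast_iff hm, eq_add_natCast_iff hjL,
    Bool.false_eq_true, if_false]
  omega

lemma droplet_left {m j : ℕ} (hm : m + 1 < L) (hj : j < m + 1) (u v : ZMod L) :
    droplet m u v true j = insert (u, v + (j : ZMod L)) (arc (u + 1) m ×ˢ arc v (m + 1)) := by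
  ext ⟨x, y⟩
  have hxu : x = u ↔ (x - u).val = 0 := by rw [ZMod.val_eq_zero, sub_eq_zero]
  have hval := val_sub_eq x u
  simp only [droplet, Finset.mem_filter, Finset.mem_univ, true_and, Finset.mem_insert,
    Finset.mem_product, mem_arc, Prod.mk.injEq, hxu, eq_add_natCast_iff (hj.trans hm), if_true]
  split_ifs at hval <;> omega

lemma exists_neighbor_mem_of_neighborCount_pos {s : Finset (Torus L)} {z : Torus L}
    (hz : 0 < neighborCount s z) :
    ((z.1, z.2 + 1) ∈ s ∨ (z.1, z.2 - 1) ∈ s) ∨ ((z.1 + 1, z.2) ∈ s ∨ (z.1 - 1, z.2) ∈ s) := by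
  by_contra! hne
  simp [neighborCount, cycleDegree, hne] at hz

lemma neighborCount_transpose (s : Finset (Torus L)) (z : Torus L) :
    neighborCount (transpose s) z.swap = neighborCount s z := by
  simp [neighborCount, add_comm]

end Droplets

section Subcritical

variable {L m : ℕ} {s t : Finset (Torus L)}

/-- Sets that are small or fit into the projections of an `m × (m + 2)` rectangle: the dynamics
cannot leave this class below the critical energy. -/
def Subcritical (m : ℕ) (s : Finset (Torus L)) : Prop :=
  s.card ≤ m * (m + 1) ∨ ((columnSupport s).card ≤ m ∧ (rowSupport s).card ≤ m + 2) ∨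
    ((columnSupport s).card ≤ m + 2 ∧ (rowSupport s).card ≤ m)

lemma Subcritical.transpose (hs : Subcritical m s) : Subcritical m (transpose s) := by
  unfold Subcritical at *
  simp only [card_transpose, columnSupport_transpose, rowSupport_transpose]
  tauto

lemma Subcritical.mono (hs : Subcritical m s) (hts : t ⊆ s) : Subcritical m t := by
  have hcard := Finset.card_le_card hts
  have hcol : (columnSupport t).card ≤ (columnSupport s).card :=
    Finset.card_le_card (Finset.image_subset_image hts)
  have hrow : (rowSupport t).card ≤ (rowSupport s).card :=
    Finset.card_le_card (Finset.image_subset_image hts)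
  unfold Subcritical at *
  omega

lemma Subcritical.card_le (hs : Subcritical m s) : s.card ≤ m * (m + 2) := by
  have hbox := card_le_card_columnSupport_mul_card_rowSupport s
  rcases hs with hcard | ⟨hcol, hrow⟩ | ⟨hcol, hrow⟩
  · nlinarith
  · exact hbox.trans (Nat.mul_le_mul hcol hrow)
  · rw [mul_comm]
    exact hbox.trans (Nat.mul_le_mul hcol hrow)

variable [NeZero L]

lemma subcritical_insert_arc_product {u v : ZMod L} (hL : m < L) {p : ZMod L} (hp : p ∈ arc u m)
    (q : ZMod L) : Subcritical m (insert (p, q) (arc u m ×ˢ arc v (m + 1))) := by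
  refine Or.inr (Or.inl ⟨?_, ?_⟩)
  · refine (Finset.card_le_card ?_).trans_eq (card_arc u hL.le)
    rw [columnSupport, Finset.image_insert]
    exact Finset.insert_subset hp Finset.subset_product_image_fst
  · refine (Finset.card_le_card (t := insert q (arc v (m + 1))) ?_).trans
      ((Finset.card_insert_le _ _).trans_eq ?_)
    · rw [rowSupport, Finset.image_insert]
      exact Finset.insert_subset_insert _ Finset.subset_product_image_snd
    · rw [card_arc v hL]

lemma subcritical_or_mem_critDroplets_insert_arc_product (hL : m + 1 < L) {u v : ZMod L}
    {z : Torus L} (hz : z ∉ arc u m ×ˢ arc v (m + 1))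
    (hn : 0 < neighborCount (arc u m ×ˢ arc v (m + 1)) z) :
    Subcritical m (insert z (arc u m ×ˢ arc v (m + 1))) ∨
      insert z (arc u m ×ˢ arc v (m + 1)) ∈ critDroplets L m := by
  obtain ⟨p, q⟩ := z
  by_cases hp : p ∈ arc u m
  · exact Or.inl (subcritical_insert_arc_product (by omega) hp q)
  right
  have hnbr : (p + 1 ∈ arc u m ∨ p - 1 ∈ arc u m) ∧ q ∈ arc v (m + 1) := by
    simpa only [Finset.mem_product, hp, false_and, or_self, false_or, ← or_and_right] using
      exists_neighbor_mem_of_neighborCount_pos hn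
  have hq : q = v + ((q - v).val : ZMod L) := by simp
  have hlt := mem_arc.1 hnbr.2
  rcases hnbr.1 with hmem | hmem
  · have hdroplet := droplet_left hL hlt p v
    rw [← hq, ← eq_of_add_one_mem_arc hmem hp] at hdroplet
    exact hdroplet ▸ droplet_mem_critDroplets _ _ _ hlt
  · have hdroplet := droplet_right (by omega) (by omega) hlt u v
    rw [← hq, ← eq_of_sub_one_mem_arc hmem hp] at hdroplet
    exact hdroplet ▸ droplet_mem_critDroplets _ _ _ hlt

end Subcritical

/-! ### The energy barrier -/

section CriticalDroplets

variable {L m : ℕ} {h : ℝ}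

/-- The energy of the critical droplets, `m + 1` being the critical length. -/
def critEnergy (h : ℝ) (m : ℕ) : ℝ := 8 * ((m : ℝ) + 1) - 2 * h * ((m : ℝ) ^ 2 + m + 1)

lemma critEnergy_pos (h_pos : 0 < h) (h_lt : h < 1) (hh : h * m ≤ 2) : 0 < critEnergy h m := by
  unfold critEnergy
  nlinarith [m.cast_nonneg (α := ℝ)]

variable [NeZero L]

lemma cycleBoundary_arc_le_two (u : ZMod L) (a : ℕ) : cycleBoundary (arc u a) ≤ 2 := by
  refine (Finset.card_le_card (t := {u - 1, u + a - 1}) fun y hy => ?_).trans Finset.card_le_two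
  simp only [Finset.mem_filter, Finset.mem_univ, true_and] at hy
  simp only [Finset.mem_insert, Finset.mem_singleton]
  by_cases hmem : y ∈ arc u a
  · right
    rw [← eq_of_sub_one_mem_arc (by simpa using hmem) (by tauto : y + 1 ∉ arc u a),
      add_sub_cancel_right]
  · left
    rw [eq_of_add_one_mem_arc (by tauto) hmem, add_sub_cancel_right]

lemma excess_arc_product_le (h : ℝ) (u v : ZMod L) {a b : ℕ} (ha : a ≤ L) (hb : b ≤ L) :
    excess h (arc u a ×ˢ arc v b) ≤ 4 * ((a : ℝ) + b) - 2 * h * (a * b) := by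
  have hP : perimeter (arc u a ×ˢ arc v b) ≤ a * 2 + b * 2 := by
    rw [perimeter_product, card_arc u ha, card_arc v hb]
    gcongr <;> exact cycleBoundary_arc_le_two _ _
  have hP' : (perimeter (arc u a ×ˢ arc v b) : ℝ) ≤ a * 2 + b * 2 := by exact_mod_cast hP
  rw [excess, Finset.card_product, card_arc u ha, card_arc v hb]
  push_cast
  linarith

lemma add_natCast_mem_arc {a j : ℕ} (hj : j < a) (ha : a ≤ L) (u : ZMod L) :
    u + (j : ZMod L) ∈ arc u a := by
  rwa [mem_arc, add_sub_cancel_left, ZMod.val_natCast_of_lt (hj.trans_le ha)]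

lemma droplet_eq_insert (hm : 0 < m) (hL : m + 1 < L) (u v : ZMod L) (e : Bool) {j : ℕ}
    (hj : j < m + 1) :
    ∃ u' c d : ZMod L, droplet m u v e j = insert (c, d) (arc u' m ×ˢ arc v (m + 1)) ∧
      c ∉ arc u' m ∧ (c + 1 ∈ arc u' m ∨ c - 1 ∈ arc u' m) ∧ d ∈ arc v (m + 1) ∧
      insert c (arc u' m) = arc u (m + 1) := by
  have hd : v + (j : ZMod L) ∈ arc v (m + 1) := add_natCast_mem_arc hj hL.le v
  have hmL : m < L := by omega
  cases e
  · refine ⟨u, u + m, v + j, droplet_right hmL (by omega) hj u v, ?_, Or.inr ?_, hd, ?_⟩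
    · simp [ZMod.val_natCast_of_lt hmL]
    · have hpred : u + (m : ZMod L) - 1 = u + ((m - 1 : ℕ) : ZMod L) := by
        rw [Nat.cast_sub hm, Nat.cast_one, add_sub_assoc]
      exact hpred ▸ add_natCast_mem_arc (by omega) hmL.le u
    · ext x
      simp only [Finset.mem_insert, mem_arc, eq_add_natCast_iff hmL]
      omega
  · refine ⟨u + 1, u, v + j, droplet_left hL hj u v, ?_, Or.inl ?_, hd, ?_⟩
    · have hval := val_sub_eq u u
      simp only [sub_self, ZMod.val_zero] at hval
      rw [mem_arc]
      split_ifs at hval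
      omega
    · simpa using hm
    · ext x
      have hxu : x = u ↔ (x - u).val = 0 := by rw [ZMod.val_eq_zero, sub_eq_zero]
      have hval := val_sub_eq x u
      simp only [Finset.mem_insert, mem_arc, hxu]
      split_ifs at hval <;> omega

lemma neighborCount_product_pos {C D : Finset (ZMod L)} {c d : ZMod L}
    (hc : c + 1 ∈ C ∨ c - 1 ∈ C) (hd : d ∈ D) : 0 < neighborCount (C ×ˢ D) (c, d) := by
  unfold neighborCount cycleDegree
  simp only [mem_row, mem_column, Finset.mem_product, hd, and_true]
  rcases hc with hc | hc
  · simp [hc]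
  · simp [hc]

lemma critEnergy_le_excess_of_card (hL : 2 * (m + 1) < L) (h : ℝ) {s : Finset (Torus L)}
    (hs : s.card = m * (m + 1) + 1) : critEnergy h m ≤ excess h s := by
  have hP : 4 * ((m : ℝ) + 1) ≤ perimeter s := by
    exact_mod_cast le_perimeter_of_card hL (s := s) (by omega) (by rw [hs]; nlinarith)
  unfold critEnergy excess
  rw [hs]
  push_cast
  linarith

lemma excess_droplet (hm : 0 < m) (hL : 2 * (m + 1) < L) (h : ℝ) (u v : ZMod L) (e : Bool)
    {j : ℕ} (hj : j < m + 1) : excess h (droplet m u v e j) = critEnergy h m := by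
  obtain ⟨u', c, d, heq, hc, hadj, hd, -⟩ := droplet_eq_insert hm (by omega) u v e hj
  have hnotMem : (c, d) ∉ arc u' m ×ˢ arc v (m + 1) := fun hx => hc (Finset.mem_product.1 hx).1
  rw [heq]
  refine le_antisymm ?_ (critEnergy_le_excess_of_card hL h ?_)
  · have hrect := excess_arc_product_le h u' v (show m ≤ L by omega) (show m + 1 ≤ L by omega)
    have hn : (1 : ℝ) ≤ neighborCount (arc u' m ×ˢ arc v (m + 1)) (c, d) := by
      exact_mod_cast neighborCount_product_pos hadj hd
    rw [excess_insert (by omega) h hnotMem, critEnergy]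
    push_cast at hrect
    linarith
  · rw [Finset.card_insert_of_notMem hnotMem, Finset.card_product, card_arc _ (by omega),
      card_arc _ (by omega)]

lemma excess_of_mem_critDroplets (hm : 0 < m) (hL : 2 * (m + 1) < L) (h : ℝ)
    {s : Finset (Torus L)} (hs : s ∈ critDroplets L m) : excess h s = critEnergy h m := by
  obtain ⟨u, v, e, j, hj, rfl | rfl⟩ := mem_critDroplets_iff.1 hs
  · exact excess_droplet hm hL h u v e hj
  · rw [excess_transpose, excess_droplet hm hL h u v e hj]

end CriticalDroplets

section SubcriticalBoundary

variable {L m : ℕ} [NeZero L] {h : ℝ} {s : Finset (Torus L)} {z : Torus L}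

lemma subcritical_insert_or_le_excess_of_card_columnSupport_le (hL : 2 * (m + 1) < L)
    (h_pos : 0 < h) (hz : z ∉ s) (hlt : m * (m + 1) < s.card) (hc : (columnSupport s).card ≤ m)
    (hr : (rowSupport s).card ≤ m + 2) :
    Subcritical m (insert z s) ∨
      critEnergy h m + (4 - 2 * (h * m)) ≤ excess h (insert z s) := by
  have hbox := card_le_card_columnSupport_mul_card_rowSupport s
  have hr' : (rowSupport s).card = m + 2 := by
    by_contra hne
    exact (hlt.trans_le hbox).not_ge (Nat.mul_le_mul hc (by omega))
  have hc' : (columnSupport s).card = m := by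
    by_contra hne
    have hmul := Nat.mul_le_mul_right (rowSupport s).card
      (show (columnSupport s).card + 1 ≤ m by omega)
    rw [hr'] at hbox hmul
    linarith
  by_cases hsub : (columnSupport (insert z s)).card ≤ m ∧ (rowSupport (insert z s)).card ≤ m + 2
  · exact Or.inl (Or.inr (Or.inl hsub))
  right
  have hcol : (columnSupport s).card ≤ (columnSupport (insert z s)).card :=
    Finset.card_le_card (Finset.image_subset_image (Finset.subset_insert _ _))
  have hrow : (rowSupport s).card ≤ (rowSupport (insert z s)).card :=
    Finset.card_le_card (Finset.image_subset_image (Finset.subset_insert _ _))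
  have hcard : (insert z s).card ≤ (m + 1) ^ 2 := by
    rw [hr', hc'] at hbox
    rw [Finset.card_insert_of_notMem hz]
    linarith
  have hP : 4 * (m + 1) + 2 ≤ perimeter (insert z s) := by
    rcases isoperimetric hL hcard with hwind | hbox' <;> omega
  have hP' : 4 * ((m : ℝ) + 1) + 2 ≤ perimeter (insert z s) := by exact_mod_cast hP
  have hcard' : ((insert z s).card : ℝ) ≤ ((m : ℝ) + 1) ^ 2 := by exact_mod_cast hcard
  unfold critEnergy excess
  linarith [mul_le_mul_of_nonneg_left hcard' h_pos.le]

lemma subcritical_insert_or_le_excess (hL : 2 * (m + 1) < L) (h_pos : 0 < h)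
    (hs : Subcritical m s) (hz : z ∉ s) (hlt : m * (m + 1) < s.card) :
    Subcritical m (insert z s) ∨
      critEnergy h m + (4 - 2 * (h * m)) ≤ excess h (insert z s) := by
  rcases hs with hcard | ⟨hc, hr⟩ | ⟨hc, hr⟩
  · omega
  · exact subcritical_insert_or_le_excess_of_card_columnSupport_le hL h_pos hz hlt hc hr
  · have htranspose := subcritical_insert_or_le_excess_of_card_columnSupport_le
      (s := transpose s) (z := z.swap) hL h_pos (by simpa using hz) (by simpa using hlt)
      (by simpa using hr) (by simpa using hc)
    rw [← transpose_insert, excess_transpose] at htranspose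
    exact htranspose.imp_left fun hsub => by simpa using hsub.transpose

lemma neighborCount_pos_of_perimeter_insert_le (hm : 0 < m) (hL : 2 * (m + 1) < L) (hz : z ∉ s)
    (hcard : s.card = m * (m + 1)) (hP : perimeter (insert z s) ≤ 4 * (m + 1)) :
    0 < neighborCount s z := by
  have hinsert := perimeter_insert (by omega : 1 < L) hz
  rcases isoperimetric hL (s := s) (by rw [hcard]; nlinarith) with hwind | hbox
  · omega
  · have hle := card_le_card_columnSupport_mul_card_rowSupport s
    have hsum : 2 * m < (columnSupport s).card + (rowSupport s).card := by
      by_contra! hsum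
      rcases eq_or_eq_of_add_le_of_le_mul hm (hsum.trans (Nat.le_succ _)) (hcard ▸ hle) <;> omega
    omega

lemma subcritical_or_mem_critDroplets_insert_of_perimeter_le (hm : 2 ≤ m)
    (hL : 2 * (m + 1) < L) (hz : z ∉ s) (hcard : s.card = m * (m + 1))
    (hP : perimeter s < 4 * (m + 1)) (hP' : perimeter (insert z s) ≤ 4 * (m + 1)) :
    Subcritical m (insert z s) ∨ insert z s ∈ critDroplets L m := by
  have hn := neighborCount_pos_of_perimeter_insert_le (by omega) hL hz hcard hP'
  obtain ⟨u, v, rfl | rfl⟩ := exists_eq_arc_product_of_perimeter_lt hm hL hcard hP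
  · exact subcritical_or_mem_critDroplets_insert_arc_product (by omega) hz hn
  · have htr : transpose (arc u (m + 1) ×ˢ arc v m) = arc v m ×ˢ arc u (m + 1) :=
      transpose_product _ _
    have htranspose := subcritical_or_mem_critDroplets_insert_arc_product (m := m) (by omega)
      (z := z.swap) (u := v) (v := u) (by rw [← htr]; simpa using hz)
      (by rwa [← htr, neighborCount_transpose])
    rw [← htr, ← transpose_insert] at htranspose
    refine htranspose.imp (fun hsub => ?_) fun hmem => ?_
    · simpa using hsub.transpose
    · simpa using transpose_mem_critDroplets hmem

/-- When `2 / h` is an integer, critical droplets are not the only exits at the critical energy. -/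
lemma subcritical_or_mem_critDroplets_insert (hm : 2 ≤ m) (hL : 2 * (m + 1) < L) (h_pos : 0 < h)
    (hh : h * m ≤ 2) (hs : Subcritical m s) (hz : z ∉ s) (hE : excess h s ≤ critEnergy h m)
    (hE' : excess h (insert z s) ≤ critEnergy h m) :
    Subcritical m (insert z s) ∨ insert z s ∈ critDroplets L m ∨
      (excess h (insert z s) = critEnergy h m ∧ h * m = 2) := by
  rcases Nat.lt_or_ge (m * (m + 1)) s.card with hlt | hle
  · refine (subcritical_insert_or_le_excess hL h_pos hs hz hlt).imp_right fun hge => ?_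
    exact Or.inr ⟨by linarith, by linarith⟩
  by_cases hsub : (insert z s).card ≤ m * (m + 1)
  · exact Or.inl (Or.inl hsub)
  have hinsert := Finset.card_insert_of_notMem hz
  have hcard : s.card = m * (m + 1) := by omega
  rw [← or_assoc]
  left
  refine subcritical_or_mem_critDroplets_insert_of_perimeter_le hm hL hz hcard ?_ ?_
  · rw [excess, critEnergy, hcard] at hE
    push_cast at hE
    have hP : (perimeter s : ℝ) < 4 * (m + 1) := by linarith
    exact_mod_cast hP
  · rw [excess, critEnergy, hinsert, hcard] at hE'
    push_cast at hE'
    have hP' : (perimeter (insert z s) : ℝ) ≤ 4 * (m + 1) := by linarith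
    exact_mod_cast hP'

lemma Subcritical.excess_pos (hm : 2 ≤ m) (hL : 2 * (m + 1) < L) (h_pos : 0 < h)
    (h_lt : h < 1) (hh : h * m ≤ 2) (hs : Subcritical m s) (hne : s.Nonempty) :
    0 < excess h s := by
  have hpos : (0 : ℝ) < s.card := by exact_mod_cast hne.card_pos
  have hcard : (s.card : ℝ) ≤ m * (m + 2) := by exact_mod_cast hs.card_le
  have hm' : (2 : ℝ) ≤ m := by exact_mod_cast hm
  have hfield : h * s.card ≤ 2 * (m + 2) := by nlinarith
  suffices hP : h * s.card < perimeter s by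
    unfold excess
    linarith
  rcases isoperimetric hL (s := s) (by nlinarith [hs.card_le]) with hwind | hbox
  · have hwind' : 4 * ((m : ℝ) + 1) + 2 ≤ perimeter s := by exact_mod_cast hwind
    linarith
  · have hbox' : 2 * (((columnSupport s).card : ℝ) + (rowSupport s).card) ≤ perimeter s := by
      exact_mod_cast hbox
    have hle : (s.card : ℝ) ≤ (columnSupport s).card * (rowSupport s).card := by
      exact_mod_cast card_le_card_columnSupport_mul_card_rowSupport s
    have hsq : h * (h * s.card) ≤ 8 := by nlinarith
    refine (lt_of_pow_lt_pow_left₀ 2 (by positivity) ?_).trans_le hbox'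
    nlinarith [sq_nonneg (((columnSupport s).card : ℝ) - (rowSupport s).card)]

end SubcriticalBoundary

section Confining

variable {L m : ℕ} [NeZero L] {h : ℝ} {s t : Finset (Torus L)} {z : Torus L}

lemma neighborCount_congr {Q : Torus L → Prop} (hst : ∀ w, Q w → (w ∈ s ↔ w ∈ t))
    (hup : Q (z.1, z.2 + 1)) (hdown : Q (z.1, z.2 - 1)) (hright : Q (z.1 + 1, z.2))
    (hleft : Q (z.1 - 1, z.2)) : neighborCount s z = neighborCount t z := by
  simp [neighborCount, cycleDegree, hst _ hup, hst _ hdown, hst _ hright, hst _ hleft]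

lemma neighborCount_erase_self (hL : 1 < L) (s : Finset (Torus L)) (z : Torus L) :
    neighborCount (s.erase z) z = neighborCount s z := by
  have : Fact (1 < L) := ⟨hL⟩
  refine neighborCount_congr (Q := (· ≠ z)) (fun w hw => by simp [hw]) ?_ ?_ ?_ ?_ <;>
    simp [Prod.ext_iff]

lemma excess_symmDiff_singleton_lt_or_of_notMem (hL : 1 < L) (h_pos : 0 < h) (h_lt : h < 1)
    (hs : z ∉ s) (ht : z ∈ t) (hn : neighborCount s z = neighborCount t z) :
    excess h (symmDiff s {z}) < excess h s ∨ excess h (symmDiff t {z}) < excess h t := by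
  have hins : symmDiff s {z} = insert z s := by
    ext w
    by_cases hw : w = z <;> simp [Finset.mem_symmDiff, hw, hs]
  have hera : symmDiff t {z} = t.erase z := by
    ext w
    by_cases hw : w = z <;> simp [Finset.mem_symmDiff, hw, ht]
  have hexcess := excess_insert hL h hs
  have hexcess' := excess_insert hL h (Finset.notMem_erase z t)
  rw [Finset.insert_erase ht, neighborCount_erase_self hL, ← hn] at hexcess'
  rw [hins, hera, hexcess, hexcess']
  rcases Nat.lt_or_ge (neighborCount s z) 2 with hlt | hge
  · right
    have hle : (neighborCount s z : ℝ) ≤ 1 := by exact_mod_cast Nat.lt_succ_iff.1 hlt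
    linarith
  · left
    have hge' : (2 : ℝ) ≤ neighborCount s z := by exact_mod_cast hge
    linarith

lemma excess_symmDiff_singleton_lt_or (hL : 1 < L) (h_pos : 0 < h) (h_lt : h < 1)
    (hz : z ∈ symmDiff s t) (hn : neighborCount s z = neighborCount t z) :
    excess h (symmDiff s {z}) < excess h s ∨ excess h (symmDiff t {z}) < excess h t := by
  rcases Finset.mem_symmDiff.1 hz with ⟨hs, ht⟩ | ⟨ht, hs⟩
  · exact (excess_symmDiff_singleton_lt_or_of_notMem hL h_pos h_lt ht hs hn.symm).symm
  · exact excess_symmDiff_singleton_lt_or_of_notMem hL h_pos h_lt hs ht hn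

/-- A class `Adm` of admissible sets, containing all the sets below the critical energy, within
which adding a site does not lead out of the subcritical sets. -/
structure Confining (h : ℝ) (m : ℕ) (Adm : Finset (Torus L) → Prop) : Prop where
  of_lt : ∀ s, excess h s < critEnergy h m → Adm s
  le : ∀ s, Adm s → excess h s ≤ critEnergy h m
  step : ∀ s z, z ∉ s → Subcritical m s → Adm s → Adm (insert z s) → Subcritical m (insert z s)

variable {Adm : Finset (Torus L) → Prop}

lemma confining_lt (hm : 2 ≤ m) (hL : 2 * (m + 1) < L) (h_pos : 0 < h) (hh : h * m ≤ 2) :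
    Confining h m fun s : Finset (Torus L) => excess h s < critEnergy h m where
  of_lt _ hs := hs
  le _ hs := hs.le
  step s z hz hs hE hE' := by
    rcases subcritical_or_mem_critDroplets_insert hm hL h_pos hh hs hz hE.le hE'.le with
      hsub | hmem | heq
    · exact hsub
    · exact absurd (excess_of_mem_critDroplets (by omega) hL h hmem) hE'.ne
    · exact absurd heq.1 hE'.ne

lemma confining_notMem_critDroplets (hm : 2 ≤ m) (hL : 2 * (m + 1) < L) (h_pos : 0 < h)
    (hh : h * m < 2) : Confining h m fun s : Finset (Torus L) =>
      excess h s ≤ critEnergy h m ∧ s ∉ critDroplets L m where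
  of_lt _ hs := ⟨hs.le, fun hmem => hs.ne (excess_of_mem_critDroplets (by omega) hL h hmem)⟩
  le _ hs := hs.1
  step s z hz hs hE hE' := by
    rcases subcritical_or_mem_critDroplets_insert hm hL h_pos hh.le hs hz hE.1 hE'.1 with
      hsub | hmem | heq
    · exact hsub
    · exact absurd hmem hE'.2
    · exact absurd heq.2 hh.ne

lemma Confining.subcritical_symmDiff_singleton (hAdm : Confining h m Adm) (hs : Subcritical m s)
    (hAs : Adm s) (hAs' : Adm (symmDiff s {z})) : Subcritical m (symmDiff s {z}) := by
  by_cases hz : z ∈ s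
  · refine hs.mono fun w hw => ?_
    rw [Finset.mem_symmDiff, Finset.mem_singleton] at hw
    rcases hw with ⟨hw, -⟩ | ⟨rfl, -⟩ <;> assumption
  · have hins : symmDiff s {z} = insert z s := by
      ext w
      by_cases hw : w = z <;> simp [Finset.mem_symmDiff, hw, hz]
    rw [hins] at hAs' ⊢
    exact hAdm.step s z hz hs hAs hAs'

/-- Simultaneous flips on one sublattice: since one of the two sets loses energy when a differing
site is flipped back, `s` and `t` are joined by single flips through admissible sets. -/
theorem Confining.subcritical_of_forall_mem_iff (hAdm : Confining h m Adm) (hL : 1 < L)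
    (h_pos : 0 < h) (h_lt : h < 1) {Q : Torus L → Prop}
    (hQ : ∀ z : Torus L, ¬ Q z →
      Q (z.1, z.2 + 1) ∧ Q (z.1, z.2 - 1) ∧ Q (z.1 + 1, z.2) ∧ Q (z.1 - 1, z.2))
    (hst : ∀ w, Q w → (w ∈ s ↔ w ∈ t)) (hs : Subcritical m s) (hAs : Adm s) (hAt : Adm t) :
    Subcritical m t := by
  induction hn : (symmDiff s t).card generalizing s t with
  | zero =>
    rw [Finset.card_eq_zero, ← Finset.bot_eq_empty, symmDiff_eq_bot] at hn
    exact hn ▸ hs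
  | succ n ih =>
    obtain ⟨z, hz⟩ := Finset.card_pos.1 (n.succ_pos.trans_eq hn.symm)
    have hzQ : ¬ Q z := fun hq => by
      have := hst z hq
      rw [Finset.mem_symmDiff] at hz
      tauto
    have hflip : ∀ w, Q w → ∀ r : Finset (Torus L), w ∈ symmDiff r {z} ↔ w ∈ r := fun w hw r => by
      have hne : w ≠ z := fun hwz => hzQ (hwz ▸ hw)
      simp [Finset.mem_symmDiff, hne]
    have hcard : (symmDiff (symmDiff s t) {z}).card = n := by
      have herase : symmDiff (symmDiff s t) {z} = (symmDiff s t).erase z := by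
        ext w
        by_cases hw : w = z
        · simp [Finset.mem_symmDiff (t := {z}), hw, hz]
        · simp [Finset.mem_symmDiff (t := {z}), hw]
      rw [herase, Finset.card_erase_of_mem hz, hn, Nat.add_sub_cancel]
    obtain ⟨hup, hdown, hright, hleft⟩ := hQ z hzQ
    rcases excess_symmDiff_singleton_lt_or hL h_pos h_lt hz
      (neighborCount_congr hst hup hdown hright hleft) with hlow | hlow
    · have hAs' := hAdm.of_lt _ (hlow.trans_le (hAdm.le s hAs))
      exact ih (fun w hw => (hflip w hw s).trans (hst w hw))
        (hAdm.subcritical_symmDiff_singleton hs hAs hAs') hAs' hAt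
        (by rw [symmDiff_right_comm, hcard])
    · have hAt' := hAdm.of_lt _ (hlow.trans_le (hAdm.le t hAt))
      have ht' := ih (fun w hw => (hst w hw).trans (hflip w hw t).symm) hs hAs hAt'
        (by rw [← symmDiff_assoc, hcard])
      have := hAdm.subcritical_symmDiff_singleton (z := z) ht' hAt'
      rw [symmDiff_symmDiff_cancel_right] at this
      exact this hAt

end Confining

/-! ### Counting the critical droplets -/

section Counting

variable {L m : ℕ} [NeZero L]

lemma mem_droplet_add {u v : ZMod L} {e : Bool} {j i k : ℕ} (hi : i < L) (hk : k < L) :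
    (u + (i : ZMod L), v + (k : ZMod L)) ∈ droplet m u v e j ↔
      i < m + 1 ∧ k < m + 1 ∧ (i = (if e then 0 else m) → k = j) := by
  simp [droplet, ZMod.val_natCast_of_lt hi, ZMod.val_natCast_of_lt hk]

lemma columnSupport_droplet (hL : m < L) (u v : ZMod L) (e : Bool) {j : ℕ} (hj : j < m + 1) :
    columnSupport (droplet m u v e j) = arc u (m + 1) := by
  ext x
  simp only [columnSupport, droplet, Finset.mem_image, Finset.mem_filter, Finset.mem_univ,
    true_and, mem_arc]
  constructor
  · rintro ⟨y, hy, rfl⟩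
    exact hy.1
  · refine fun hx => ⟨(x, v + (j : ZMod L)), ?_, rfl⟩
    rw [add_sub_cancel_left, ZMod.val_natCast_of_lt (by omega)]
    exact ⟨hx, hj, fun _ => rfl⟩

lemma rowSupport_droplet (hm : 2 ≤ m) (hL : m < L) (u v : ZMod L) (e : Bool) {j : ℕ} :
    rowSupport (droplet m u v e j) = arc v (m + 1) := by
  ext y
  simp only [rowSupport, droplet, Finset.mem_image, Finset.mem_filter, Finset.mem_univ, true_and,
    mem_arc]
  constructor
  · rintro ⟨y, hy, rfl⟩
    exact hy.2.1
  · refine fun hy => ⟨(u + ((1 : ℕ) : ZMod L), y), ?_, rfl⟩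
    rw [add_sub_cancel_left, ZMod.val_natCast_of_lt (by omega)]
    refine ⟨by omega, hy, fun hside => ?_⟩
    split_ifs at hside
    omega

lemma arc_injective {a : ℕ} (ha : 0 < a) (haL : a < L) :
    Function.Injective fun u : ZMod L => arc u a := by
  intro u u' (huu' : arc u a = arc u' a)
  have hmem : u - 1 + 1 ∈ arc u' a := huu' ▸ by simpa using ha
  have hnotMem : u - 1 ∉ arc u' a := huu' ▸ by
    have hval := val_add_one_eq (u - 1 - u)
    rw [show u - 1 - u + 1 = 0 by ring, ZMod.val_zero] at hval
    rw [mem_arc]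
    split_ifs at hval
    omega
  simpa using (eq_of_add_one_mem_arc hmem hnotMem).symm

lemma droplet_injective (hm : 2 ≤ m) (hL : m < L) {u v : ZMod L} {e e' : Bool} {j j' : ℕ}
    (hj : j < m + 1) (heq : droplet m u v e j = droplet m u v e' j') : e = e' ∧ j = j' := by
  have hcell : ∀ i k : ℕ, i < m + 1 → k < m + 1 →
      ((i = (if e then 0 else m) → k = j) ↔ (i = (if e' then 0 else m) → k = j')) := by
    intro i k hi hk
    have hmem := mem_droplet_add (m := m) (u := u) (v := v) (e := e) (j := j)
      (show i < L by omega) (show k < L by omega)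
    rw [heq, mem_droplet_add (by omega) (by omega)] at hmem
    tauto
  have hcorner := hcell 0 0 (by omega) (by omega)
  have hcorner' := hcell 0 1 (by omega) (by omega)
  have hleft := hcell 0 j (by omega) hj
  have hright := hcell m j (by omega) hj
  cases e <;> cases e' <;> simp at hcorner hcorner' hleft hright ⊢ <;> omega

lemma droplet_ne_transpose (hm : 2 ≤ m) (hL : m < L) {u v : ZMod L} {e e' : Bool} {j j' : ℕ} :
    droplet m u v e j ≠ transpose (droplet m v u e' j') := by
  intro heq
  have hcell : ∀ i k : ℕ, i < m + 1 → k < m + 1 →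
      ((i = (if e then 0 else m) → k = j) ↔ (k = (if e' then 0 else m) → i = j')) := by
    intro i k hi hk
    have hmem := mem_droplet_add (m := m) (u := u) (v := v) (e := e) (j := j)
      (show i < L by omega) (show k < L by omega)
    rw [heq, mem_transpose, Prod.swap_prod_mk, mem_droplet_add (by omega) (by omega)] at hmem
    tauto
  have hside : (if e then 0 else m) < m + 1 := by split_ifs <;> omega
  have hcell₀ := hcell _ 0 hside (by omega)
  have hcell₁ := hcell _ 1 hside (by omega)
  have hcell₂ := hcell _ 2 hside (by omega)
  have hcell₃ := hcell _ m hside (by omega)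
  cases e' <;> simp at hcell₀ hcell₁ hcell₂ hcell₃ <;> omega

lemma columnSupport_critDroplet (hm : 2 ≤ m) (hL : m < L)
    (p : Torus L × Bool × Bool × Fin (m + 1)) :
    columnSupport (critDroplet m p) = arc p.1.1 (m + 1) := by
  obtain ⟨⟨u, v⟩, o, e, j⟩ := p
  cases o
  · simpa [critDroplet] using columnSupport_droplet hL u v e j.2
  · simpa [critDroplet] using rowSupport_droplet hm hL v u e

lemma rowSupport_critDroplet (hm : 2 ≤ m) (hL : m < L)
    (p : Torus L × Bool × Bool × Fin (m + 1)) :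
    rowSupport (critDroplet m p) = arc p.1.2 (m + 1) := by
  obtain ⟨⟨u, v⟩, o, e, j⟩ := p
  cases o
  · simpa [critDroplet] using rowSupport_droplet hm hL u v e
  · simpa [critDroplet] using columnSupport_droplet hL v u e j.2

lemma critDroplet_injective (hm : 2 ≤ m) (hL : m + 1 < L) :
    Function.Injective (critDroplet (L := L) m) := by
  have hmL : m < L := by omega
  rintro ⟨⟨u, v⟩, o, e, j⟩ ⟨⟨u', v'⟩, o', e', j'⟩ heq
  obtain rfl : u = u' := arc_injective m.succ_pos hL
    (by simpa only [columnSupport_critDroplet hm hmL] using congrArg columnSupport heq)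
  obtain rfl : v = v' := arc_injective m.succ_pos hL
    (by simpa only [rowSupport_critDroplet hm hmL] using congrArg rowSupport heq)
  have hsame : e = e' ∧ (j : ℕ) = j' → o = o' →
      (((u, v), o, e, j) : Torus L × Bool × Bool × Fin (m + 1)) = ((u, v), o', e', j') := by
    rintro ⟨rfl, hj⟩ rfl
    rw [Fin.ext hj]
  cases o <;> cases o'
  · exact hsame (droplet_injective hm hmL j.2 (by simpa [critDroplet] using heq)) rfl
  · exact absurd (by simpa [critDroplet] using heq) (droplet_ne_transpose hm hmL)
  · exact absurd (by simpa [critDroplet] using heq.symm) (droplet_ne_transpose hm hmL)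
  · refine hsame (droplet_injective hm hmL (u := v) (v := u) j.2 ?_) rfl
    simpa [critDroplet] using congrArg transpose heq

lemma card_critDroplets (hm : 2 ≤ m) (hL : m + 1 < L) :
    (critDroplets L m).card = 4 * (m + 1) * L ^ 2 := by
  rw [critDroplets, Finset.card_image_of_injective _ (critDroplet_injective hm hL),
    Finset.card_univ]
  simp only [Fintype.card_prod, ZMod.card, Fintype.card_bool, Fintype.card_fin]
  ring

end Counting

/-! ### Growth of droplets -/

section Parity

variable {L : ℕ}

/-- The even sublattice. -/
def EvenSite (x : Torus L) : Prop := Even (x.1.val + x.2.val)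

lemma evenSite_swap (x : Torus L) : EvenSite x.swap ↔ EvenSite x := by
  simp [EvenSite, add_comm]

variable [NeZero L]

lemma even_val_add_one_add (hL : Even L) (x : ZMod L) (n : ℕ) :
    Even ((x + 1).val + n) ↔ ¬ Even (x.val + n) := by
  rw [val_add_one_eq]
  split_ifs with hx <;> simp only [Nat.even_iff] at * <;> omega

lemma evenSite_right (hL : Even L) (x y : ZMod L) : EvenSite (x + 1, y) ↔ ¬ EvenSite (x, y) :=
  even_val_add_one_add hL x _

lemma evenSite_up (hL : Even L) (x y : ZMod L) : EvenSite (x, y + 1) ↔ ¬ EvenSite (x, y) := by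
  simpa only [EvenSite, add_comm] using even_val_add_one_add hL y x.val

lemma evenSite_left (hL : Even L) (x y : ZMod L) : EvenSite (x - 1, y) ↔ ¬ EvenSite (x, y) := by
  rw [← not_iff_not, not_not, ← evenSite_right hL, sub_add_cancel]

lemma evenSite_down (hL : Even L) (x y : ZMod L) : EvenSite (x, y - 1) ↔ ¬ EvenSite (x, y) := by
  rw [← not_iff_not, not_not, ← evenSite_up hL, sub_add_cancel]

end Parity

section Grow

variable {L : ℕ} [NeZero L] {h : ℝ} {K : Set ℝ}

/-- `t` is obtained from `s` by adding sites one at a time, through sets with energy in `K`. -/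
def Grow (h : ℝ) (K : Set ℝ) : Finset (Torus L) → Finset (Torus L) → Prop :=
  Relation.ReflTransGen fun s t => excess h t ∈ K ∧ ∃ z ∉ s, t = insert z s

lemma Grow.transpose {s t : Finset (Torus L)} (hst : Grow h K s t) :
    Grow h K (transpose s) (transpose t) := by
  induction hst with
  | refl => exact Relation.ReflTransGen.refl
  | tail _ hstep ih =>
    obtain ⟨hE, z, hz, rfl⟩ := hstep
    exact ih.tail ⟨by rwa [excess_transpose], z.swap, by simpa using hz, transpose_insert _ _⟩

/-- Filling a site with at least two occupied neighbours does not raise the energy. -/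
lemma grow_of_forall_exists_two_le_neighborCount (hL : 1 < L) (h_pos : 0 < h)
    (hK : IsLowerSet K) {w T : Finset (Torus L)} (hwT : w ⊆ T) (hE : excess h w ∈ K)
    (hfill : ∀ w', w ⊆ w' → w' ⊂ T → ∃ y ∈ T, y ∉ w' ∧ 2 ≤ neighborCount w' y) :
    Grow h K w T := by
  induction hn : (T \ w).card generalizing w with
  | zero =>
    rw [hwT.antisymm (Finset.sdiff_eq_empty_iff_subset.1 (Finset.card_eq_zero.1 hn))]
    exact Relation.ReflTransGen.refl
  | succ n ih =>
    have hne : w ≠ T := by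
      rintro rfl
      simp at hn
    obtain ⟨y, hyT, hyw, hy⟩ := hfill w subset_rfl (hwT.ssubset_of_ne hne)
    have hE' : excess h (insert y w) ∈ K := by
      refine hK ?_ hE
      have hy' : (2 : ℝ) ≤ neighborCount w y := by exact_mod_cast hy
      rw [excess_insert hL h hyw]
      linarith
    refine Relation.ReflTransGen.head ⟨hE', y, hyw, rfl⟩ (ih (Finset.insert_subset hyT hwT) hE'
      (fun w' hw' => hfill w' ((Finset.subset_insert _ _).trans hw')) ?_)
    rw [Finset.sdiff_insert, Finset.card_erase_of_mem (Finset.mem_sdiff.2 ⟨hyT, hyw⟩), hn,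
      Nat.add_sub_cancel]

lemma two_le_neighborCount {s : Finset (Torus L)} {z : Torus L}
    (hcol : (z.1, z.2 + 1) ∈ s ∨ (z.1, z.2 - 1) ∈ s)
    (hrow : (z.1 + 1, z.2) ∈ s ∨ (z.1 - 1, z.2) ∈ s) : 2 ≤ neighborCount s z := by
  unfold neighborCount cycleDegree
  simp only [mem_row, mem_column]
  rcases hcol with hcol | hcol <;> rcases hrow with hrow | hrow <;>
    simp only [hcol, hrow, if_true] <;> omega

lemma exists_mem_arc_adjacent {D : Finset (ZMod L)} {v d y : ZMod L} {b : ℕ} (hb : b ≤ L)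
    (hd : d ∈ arc v b) (hdD : d ∈ D) (hy : y ∈ arc v b) (hyD : y ∉ D) :
    ∃ x ∈ arc v b, x ∉ D ∧ (x + 1 ∈ D ∨ x - 1 ∈ D) := by
  by_contra! hclosed
  have hconst : ∀ i < b, v + (i : ZMod L) ∈ D ↔ v ∈ D := fun i => by
    induction i with
    | zero => simp
    | succ i ih =>
      intro hi
      rw [← ih (by omega), Nat.cast_succ, ← add_assoc]
      have hmem := add_natCast_mem_arc (show i < b by omega) hb v
      have hmem' := add_natCast_mem_arc hi hb v
      rw [Nat.cast_succ, ← add_assoc] at hmem'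
      refine ⟨fun hD => ?_, fun hD => ?_⟩ <;> by_contra hnot
      · exact (hclosed _ hmem hnot).1 hD
      · exact (hclosed _ hmem' hnot).2 (by simpa using hD)
  have hd' := hconst _ (mem_arc.1 hd)
  have hy' := hconst _ (mem_arc.1 hy)
  rw [ZMod.natCast_zmod_val, add_sub_cancel] at hd' hy'
  exact hyD (hy'.2 (hd'.1 hdD))

lemma grow_insert_product_arc (hL : 1 < L) (h_pos : 0 < h) (hK : IsLowerSet K)
    {C : Finset (ZMod L)} {c d v : ZMod L} {b : ℕ} (hb : b ≤ L) (hC : c + 1 ∈ C ∨ c - 1 ∈ C)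
    (hd : d ∈ arc v b) {w : Finset (Torus L)} (hw : insert (c, d) (C ×ˢ arc v b) ⊆ w)
    (hw' : w ⊆ insert c C ×ˢ arc v b) (hE : excess h w ∈ K) :
    Grow h K w (insert c C ×ˢ arc v b) := by
  refine grow_of_forall_exists_two_le_neighborCount hL h_pos hK hw' hE fun w₁ hww₁ hw₁ => ?_
  have hsub := hw.trans hww₁
  have hC₁ : ∀ x ∈ C, ∀ y ∈ arc v b, (x, y) ∈ w₁ := fun x hx y hy =>
    hsub (Finset.mem_insert_of_mem (Finset.mem_product.2 ⟨hx, hy⟩))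
  obtain ⟨⟨x, y⟩, hxy, hxy₁⟩ := Finset.exists_of_ssubset hw₁
  rw [Finset.mem_product, Finset.mem_insert] at hxy
  obtain rfl : x = c := hxy.1.resolve_right fun hx => hxy₁ (hC₁ x hx y hxy.2)
  obtain ⟨r, hr, hr₁, hadj⟩ := exists_mem_arc_adjacent (D := column w₁ x) hb hd
    (mem_column.2 (hsub (Finset.mem_insert_self _ _))) hxy.2 (by simpa using hxy₁)
  rw [mem_column] at hr₁
  simp only [mem_column] at hadj
  exact ⟨(x, r), Finset.mem_product.2 ⟨Finset.mem_insert_self _ _, hr⟩, hr₁,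
    two_le_neighborCount hadj (hC.imp (hC₁ _ · r hr) (hC₁ _ · r hr))⟩

end Grow

section Rectangles

/-- A bound for the energy of an `a × b` rectangle with a protuberance. -/
def protuberanceBound (h : ℝ) (a b : ℕ) : ℝ := 4 * ((a : ℝ) + b) - 2 * h * (a * b) + 4 - 2 * h

lemma protuberanceBound_comm (h : ℝ) (a b : ℕ) :
    protuberanceBound h a b = protuberanceBound h b a := by
  unfold protuberanceBound
  ring

lemma protuberanceBound_square (h : ℝ) (m : ℕ) :
    protuberanceBound h m m = critEnergy h m - (4 - 2 * (h * m)) := by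
  unfold protuberanceBound critEnergy
  ring

lemma protuberanceBound_quasiSquare (h : ℝ) (m : ℕ) :
    protuberanceBound h m (m + 1) = critEnergy h m := by
  unfold protuberanceBound critEnergy
  push_cast
  ring

lemma protuberanceBound_succ_square (h : ℝ) (m : ℕ) :
    protuberanceBound h (m + 1) (m + 1) = critEnergy h m - (2 * (h * (m + 1)) - 4) := by
  unfold protuberanceBound critEnergy
  push_cast
  ring

lemma protuberanceBound_mono {h : ℝ} {a a' b : ℕ} (hb : h * b ≤ 2) (haa' : a ≤ a') :
    protuberanceBound h a b ≤ protuberanceBound h a' b := by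
  have haa'' : (a : ℝ) ≤ a' := by exact_mod_cast haa'
  unfold protuberanceBound
  nlinarith

lemma protuberanceBound_anti {h : ℝ} {a a' b : ℕ} (hb : 2 ≤ h * b) (haa' : a ≤ a') :
    protuberanceBound h a' b ≤ protuberanceBound h a b := by
  have haa'' : (a : ℝ) ≤ a' := by exact_mod_cast haa'
  unfold protuberanceBound
  nlinarith

variable {L m : ℕ} [NeZero L] {h : ℝ} {K : Set ℝ}

lemma insert_arc (u : ZMod L) {a : ℕ} (ha : a < L) :
    insert (u + (a : ZMod L)) (arc u a) = arc u (a + 1) := by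
  ext x
  simp only [Finset.mem_insert, mem_arc, eq_add_natCast_iff ha]
  omega

lemma self_mem_arc (u : ZMod L) {a : ℕ} (ha : 0 < a) : u ∈ arc u a := by simpa using ha

lemma grow_arc_product_succ (hL : 1 < L) (h_pos : 0 < h) (hK : IsLowerSet K) (u v : ZMod L)
    {a b : ℕ} (ha : 0 < a) (haL : a < L) (hb : 0 < b) (hbL : b ≤ L)
    (hE : protuberanceBound h a b ∈ K) :
    Grow h K (arc u a ×ˢ arc v b) (arc u (a + 1) ×ˢ arc v b) := by
  have hz : (u + (a : ZMod L), v) ∉ arc u a ×ˢ arc v b := by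
    simp [ZMod.val_natCast_of_lt haL]
  have hadj : u + (a : ZMod L) + 1 ∈ arc u a ∨ u + (a : ZMod L) - 1 ∈ arc u a := by
    have hpred : u + (a : ZMod L) - 1 = u + ((a - 1 : ℕ) : ZMod L) := by
      rw [Nat.cast_sub ha, Nat.cast_one, add_sub_assoc]
    exact Or.inr (hpred ▸ add_natCast_mem_arc (by omega) haL.le u)
  have hv := self_mem_arc v hb
  have hE' : excess h (insert (u + (a : ZMod L), v) (arc u a ×ˢ arc v b)) ∈ K := by
    refine hK ?_ hE
    have hrect := excess_arc_product_le h u v haL.le hbL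
    have hn : (1 : ℝ) ≤ neighborCount (arc u a ×ˢ arc v b) (u + (a : ZMod L), v) := by
      exact_mod_cast neighborCount_product_pos hadj hv
    rw [excess_insert hL h hz, protuberanceBound]
    linarith
  refine Relation.ReflTransGen.head ⟨hE', _, hz, rfl⟩ ?_
  rw [← insert_arc u haL]
  exact grow_insert_product_arc hL h_pos hK hbL hadj hv subset_rfl
    (Finset.insert_subset (Finset.mem_product.2 ⟨Finset.mem_insert_self _ _, hv⟩)
      (Finset.product_subset_product_left (Finset.subset_insert _ _))) hE'

lemma grow_arc_product_left (hL : 1 < L) (h_pos : 0 < h) (hK : IsLowerSet K) (u v : ZMod L)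
    {a a' b : ℕ} (ha : 0 < a) (haa' : a ≤ a') (ha'L : a' ≤ L) (hb : 0 < b) (hbL : b ≤ L)
    (hE : ∀ i, a ≤ i → i < a' → protuberanceBound h i b ∈ K) :
    Grow h K (arc u a ×ˢ arc v b) (arc u a' ×ˢ arc v b) := by
  induction a', haa' using Nat.le_induction with
  | base => exact Relation.ReflTransGen.refl
  | succ n han ih =>
    exact (ih (by omega) fun i hai hin => hE i hai (by omega)).trans
      (grow_arc_product_succ hL h_pos hK u v (by omega) ha'L hb hbL (hE n han n.lt_succ_self))

lemma grow_arc_product_right (hL : 1 < L) (h_pos : 0 < h) (hK : IsLowerSet K) (u v : ZMod L)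
    {a b b' : ℕ} (ha : 0 < a) (haL : a ≤ L) (hb : 0 < b) (hbb' : b ≤ b') (hb'L : b' ≤ L)
    (hE : ∀ i, b ≤ i → i < b' → protuberanceBound h a i ∈ K) :
    Grow h K (arc u a ×ˢ arc v b) (arc u a ×ˢ arc v b') := by
  have htranspose := (grow_arc_product_left hL h_pos hK v u hb hbb' hb'L ha haL
    fun i hbi hib => protuberanceBound_comm h _ _ ▸ hE i hbi hib).transpose
  rwa [transpose_product, transpose_product] at htranspose

lemma grow_empty_quasiSquare (hm : 0 < m) (hL : m + 1 < L) (h_pos : 0 < h) (hh : h * m ≤ 2)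
    (hK : IsLowerSet K) (hE : protuberanceBound h m m ∈ K) (u v : ZMod L) :
    Grow h K ∅ (arc u m ×ˢ arc v (m + 1)) := by
  have hL1 : 1 < L := by omega
  have h_le : h ≤ 2 := by
    have hm' : (1 : ℝ) ≤ m := by exact_mod_cast hm
    nlinarith
  have hE₁ : ∀ b ≤ m, protuberanceBound h m b ∈ K := fun b hb => by
    rw [protuberanceBound_comm]
    exact hK (protuberanceBound_mono hh hb) hE
  have hE₂ : ∀ a ≤ m, protuberanceBound h a 1 ∈ K := fun a ha =>
    hK (protuberanceBound_mono (by push_cast; linarith) ha) (hE₁ 1 hm)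
  have hsite : Grow h K ∅ (arc u 1 ×ˢ arc v 1) := by
    refine Relation.ReflTransGen.single ⟨hK ?_ (hE₂ 1 hm), (u, v), Finset.notMem_empty _, ?_⟩
    · have hrect := excess_arc_product_le h u v hL1.le hL1.le
      unfold protuberanceBound
      push_cast at hrect ⊢
      linarith
    · ext ⟨x, y⟩
      simp [ZMod.val_eq_zero, sub_eq_zero]
  exact (hsite.trans (grow_arc_product_left hL1 h_pos hK u v one_pos hm (by omega) one_pos hL1.le
      fun a _ ha => hE₂ a ha.le)).trans
    (grow_arc_product_right hL1 h_pos hK u v hm (by omega) one_pos (by omega) hL.le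
      fun b _ hb => hE₁ b (by omega))

lemma grow_square_univ (hm : 0 < m) (hL : m < L) (h_pos : 0 < h) (hh : 2 ≤ h * m)
    (hK : IsLowerSet K) (hE : protuberanceBound h m m ∈ K) (u v : ZMod L) :
    Grow h K (arc u m ×ˢ arc v m) Finset.univ := by
  have hL1 : 1 < L := by omega
  have hE₁ : ∀ a, m ≤ a → protuberanceBound h a m ∈ K := fun a ha =>
    hK (protuberanceBound_anti hh ha) hE
  have hE₂ : ∀ b, m ≤ b → protuberanceBound h L b ∈ K := fun b hb => by
    have hmL : (m : ℝ) ≤ L := by exact_mod_cast hL.le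
    rw [protuberanceBound_comm]
    refine hK (protuberanceBound_anti (by nlinarith) hb) ?_
    rw [protuberanceBound_comm]
    exact hE₁ L hL.le
  have huniv : arc u L ×ˢ arc v L = Finset.univ := by
    ext x
    simp [ZMod.val_lt]
  rw [← huniv]
  exact (grow_arc_product_left hL1 h_pos hK u v hm hL.le le_rfl hm hL.le
    fun a ha _ => hE₁ a ha).trans (grow_arc_product_right hL1 h_pos hK u v (by omega) le_rfl hm
      hL.le le_rfl fun b hb _ => hE₂ b hb)

lemma grow_empty_univ (hm : 0 < m) (hL : m + 1 < L) (h_pos : 0 < h) (hh : h * m ≤ 2)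
    (hh' : 2 < h * (m + 1)) :
    Grow h (Set.Iic (critEnergy h m)) (∅ : Finset (Torus L)) Finset.univ := by
  have hK : IsLowerSet (Set.Iic (critEnergy h m)) := isLowerSet_Iic _
  have hquasi := grow_empty_quasiSquare hm hL h_pos hh hK
    (by rw [protuberanceBound_square, Set.mem_Iic]; linarith) (0 : ZMod L) 0
  have hsquare := grow_arc_product_succ (by omega) h_pos hK (0 : ZMod L) 0 hm (by omega)
    (show 0 < m + 1 by omega) hL.le (protuberanceBound_quasiSquare h m).le
  have huniv := grow_square_univ m.succ_pos hL h_pos (by push_cast; exact hh'.le) hK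
    (by rw [protuberanceBound_succ_square, Set.mem_Iic]; linarith) (0 : ZMod L) 0
  exact (hquasi.trans hsquare).trans huniv

end Rectangles

section Gates

variable {L m : ℕ} [NeZero L] {h : ℝ}

/-- `s` arises from the empty set below the energy `Γ` except for its last site `z`, and after the
addition of a further site `y`, of the other parity, it grows to the whole torus below `Γ`. -/
def IsGate (h Γ : ℝ) (s : Finset (Torus L)) : Prop :=
  ∃ (R : Finset (Torus L)) (z y : Torus L), z ∉ R ∧ s = insert z R ∧ y ∉ s ∧
    (EvenSite y ↔ ¬ EvenSite z) ∧ Grow h (Set.Iio Γ) ∅ R ∧ excess h (insert y s) < Γ ∧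
    Grow h (Set.Iio Γ) (insert y s) Finset.univ

lemma IsGate.transpose {Γ : ℝ} {s : Finset (Torus L)} (hs : IsGate h Γ s) :
    IsGate h Γ (transpose s) := by
  obtain ⟨R, z, y, hz, rfl, hy, hparity, hR, hE, huniv⟩ := hs
  refine ⟨PCA.transpose R, z.swap, y.swap, by simpa using hz, transpose_insert _ _,
    by simpa using hy, by simpa only [evenSite_swap] using hparity, hR.transpose, ?_, ?_⟩
  · rwa [← transpose_insert, excess_transpose]
  · have hgrow := huniv.transpose
    rwa [← Finset.univ_product_univ, transpose_product, Finset.univ_product_univ,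
      transpose_insert] at hgrow

lemma exists_adjacent_in_arc (hL : Even L) {v d : ZMod L} {b : ℕ} (hb : 1 < b) (hbL : b ≤ L)
    (hd : d ∈ arc v b) (c : ZMod L) : ∃ y ∈ arc v b, y ≠ d ∧ (y + 1 = d ∨ y - 1 = d) ∧
      (EvenSite (c, y) ↔ ¬ EvenSite (c, d)) := by
  obtain ⟨x, hx, hxd⟩ := Finset.exists_mem_ne (by rwa [card_arc v hbL]) d
  obtain ⟨y, hy, hyd, hadj⟩ := exists_mem_arc_adjacent hbL hd (Finset.mem_singleton_self d) hx
    (by simpa using hxd)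
  simp only [Finset.mem_singleton] at hyd hadj
  refine ⟨y, hy, hyd, hadj, ?_⟩
  rcases hadj with rfl | rfl
  · rw [evenSite_up hL, not_not]
  · rw [evenSite_down hL, not_not]

lemma isGate_droplet (hm : 2 ≤ m) (hL : 2 * (m + 1) < L) (hLe : Even L) (h_pos : 0 < h)
    (hh : h * m < 2) (hh' : 2 < h * (m + 1)) (u v : ZMod L) (e : Bool) {j : ℕ} (hj : j < m + 1) :
    IsGate h (critEnergy h m) (droplet m u v e j) := by
  have hL1 : 1 < L := by omega
  have hK : IsLowerSet (Set.Iio (critEnergy h m)) := isLowerSet_Iio _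
  have hdroplet := excess_droplet (by omega) hL h u v e hj
  obtain ⟨u', c, d, heq, hc, hadj, hd, hsquare⟩ := droplet_eq_insert (by omega) (by omega) u v e hj
  obtain ⟨y, hy, hyd, hyadj, hparity⟩ := exists_adjacent_in_arc hLe (by omega) (by omega) hd c
  have hmemProduct : ∀ x ∈ arc u' m, (x, y) ∈ droplet m u v e j := fun x hx =>
    heq ▸ Finset.mem_insert_of_mem (Finset.mem_product.2 ⟨hx, hy⟩)
  have hmem : (c, d) ∈ droplet m u v e j := heq ▸ Finset.mem_insert_self _ _
  have hynotMem : (c, y) ∉ droplet m u v e j := by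
    rw [heq, Finset.mem_insert, Finset.mem_product, Prod.mk.injEq]
    tauto
  have hE : excess h (insert (c, y) (droplet m u v e j)) < critEnergy h m := by
    have hn : (2 : ℝ) ≤ neighborCount (droplet m u v e j) (c, y) := by
      exact_mod_cast two_le_neighborCount (hyadj.imp (by rintro rfl; exact hmem)
        (by rintro rfl; exact hmem)) (hadj.imp (hmemProduct _) (hmemProduct _))
    rw [excess_insert hL1 h hynotMem, hdroplet]
    linarith
  refine ⟨arc u' m ×ˢ arc v (m + 1), (c, d), (c, y), fun hx => hc (Finset.mem_product.1 hx).1,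
    heq, hynotMem, hparity, ?_, hE, ?_⟩
  · refine grow_empty_quasiSquare (by omega) (by omega) h_pos hh.le hK ?_ u' v
    rw [protuberanceBound_square, Set.mem_Iio]
    linarith
  · have hline := grow_insert_product_arc (w := insert (c, y) (droplet m u v e j)) hL1 h_pos hK
      (by omega) hadj hd (heq ▸ Finset.subset_insert _ _) (by
        rw [heq]
        simp [Finset.insert_subset_iff, hy, hd, Finset.product_subset_product_left]) hE
    rw [hsquare] at hline
    refine hline.trans (grow_square_univ m.succ_pos (by omega) h_pos (by push_cast; exact hh'.le)
      hK ?_ u v)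
    rw [protuberanceBound_succ_square, Set.mem_Iio]
    linarith

lemma isGate_of_mem_critDroplets (hm : 2 ≤ m) (hL : 2 * (m + 1) < L) (hLe : Even L)
    (h_pos : 0 < h) (hh : h * m < 2) (hh' : 2 < h * (m + 1)) {s : Finset (Torus L)}
    (hs : s ∈ critDroplets L m) : IsGate h (critEnergy h m) s := by
  obtain ⟨u, v, e, j, hj, rfl | rfl⟩ := mem_critDroplets_iff.1 hs
  · exact isGate_droplet hm hL hLe h_pos hh hh' u v e hj
  · exact (isGate_droplet hm hL hLe h_pos hh hh' u v e hj).transpose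

end Gates

/-! ### The pair of Ising configurations attached to a transition -/

section Mixing

variable {L : ℕ}

/-- The configuration whose set of pluses is `s`. -/
def ofPlusSet (s : Finset (Torus L)) : Config L := fun x => if x ∈ s then 1 else -1

open Classical in
/-- The configuration that agrees with `σ` on the even and with `η` on the odd sublattice. When all
spins are updated at once, the even sites of `σ` interact only with the odd sites of `η`, and
conversely, so a transition from `σ` to `η` decouples into `mix σ η` and `mix η σ`. -/
def mix (σ η : Config L) : Config L := fun x => if EvenSite x then σ x else η x

lemma mix_of_evenSite {x : Torus L} (hx : EvenSite x) (σ η : Config L) : mix σ η x = σ x :=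
  if_pos hx

lemma mix_of_not_evenSite {x : Torus L} (hx : ¬ EvenSite x) (σ η : Config L) : mix σ η x = η x :=
  if_neg hx

@[simp] lemma mix_mix (σ η : Config L) : mix (mix σ η) (mix η σ) = σ := by
  funext x
  by_cases hx : EvenSite x <;> simp [mix, hx]

@[simp] lemma mix_self (σ : Config L) : mix σ σ = σ := by
  funext x
  simp [mix]

lemma ofPlusSet_empty : ofPlusSet (∅ : Finset (Torus L)) = allMinus L := by
  funext x
  simp [ofPlusSet, allMinus]

/-- The configuration that agrees with the one with pluses `s` on the even sublattice and with the
one with pluses `q` on the odd one. -/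
def interlace (s q : Finset (Torus L)) : Config L := mix (ofPlusSet s) (ofPlusSet q)

@[simp] lemma mix_interlace (s q : Finset (Torus L)) :
    mix (interlace s q) (interlace q s) = ofPlusSet s :=
  mix_mix _ _

@[simp] lemma interlace_empty_empty : interlace ∅ ∅ = allMinus L := by
  rw [interlace, mix_self, ofPlusSet_empty]

lemma interlace_insert_of_evenSite {z : Torus L} (hz : EvenSite z) (q s : Finset (Torus L)) :
    interlace q (insert z s) = interlace q s := by
  funext x
  by_cases hx : EvenSite x
  · simp [interlace, mix, hx]
  · have hxz : x ≠ z := fun hxz => hx (hxz ▸ hz)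
    simp [interlace, mix, hx, ofPlusSet, hxz]

lemma interlace_insert_of_not_evenSite {z : Torus L} (hz : ¬ EvenSite z)
    (s q : Finset (Torus L)) : interlace (insert z s) q = interlace s q := by
  funext x
  by_cases hx : EvenSite x
  · have hxz : x ≠ z := fun hxz => hz (hxz ▸ hx)
    simp [interlace, mix, hx, ofPlusSet, hxz]
  · simp [interlace, mix, hx]

lemma checkerEven_eq_mix : checkerEven L = mix (allPlus L) (allMinus L) := by
  funext x
  by_cases hx : EvenSite x
  · rw [mix_of_evenSite hx]
    exact Even.neg_one_pow hx
  · rw [mix_of_not_evenSite hx]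
    exact Odd.neg_one_pow (Nat.not_even_iff_odd.1 hx)

lemma checkerOdd_eq_mix : checkerOdd L = mix (allMinus L) (allPlus L) := by
  funext x
  by_cases hx : EvenSite x
  · rw [mix_of_evenSite hx]
    exact Odd.neg_one_pow (Even.add_one hx)
  · rw [mix_of_not_evenSite hx]
    exact Even.neg_one_pow (Odd.add_one (Nat.not_even_iff_odd.1 hx))

variable [NeZero L]

/-- The set of pluses of a configuration. -/
def plusSet (σ : Config L) : Finset (Torus L) := Finset.univ.filter fun x => σ x = 1

@[simp] lemma mem_plusSet {σ : Config L} {x : Torus L} : x ∈ plusSet σ ↔ σ x = 1 := by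
  simp [plusSet]

@[simp] lemma plusSet_ofPlusSet (s : Finset (Torus L)) : plusSet (ofPlusSet s) = s := by
  ext x
  by_cases hx : x ∈ s <;> simp [ofPlusSet, hx]

@[simp] lemma ofPlusSet_plusSet (σ : Config L) : ofPlusSet (plusSet σ) = σ := by
  funext x
  rcases Int.units_eq_one_or (σ x) with hx | hx <;> simp [ofPlusSet, hx]

lemma ofPlusSet_univ : ofPlusSet (Finset.univ : Finset (Torus L)) = allPlus L := by
  funext x
  simp [ofPlusSet, allPlus]

@[simp] lemma interlace_univ_univ : interlace Finset.univ Finset.univ = allPlus L := by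
  rw [interlace, mix_self, ofPlusSet_univ]

lemma interlace_univ_empty : interlace Finset.univ ∅ = checkerEven L := by
  rw [interlace, ofPlusSet_univ, ofPlusSet_empty, checkerEven_eq_mix]

lemma interlace_empty_univ : interlace ∅ Finset.univ = checkerOdd L := by
  rw [interlace, ofPlusSet_univ, ofPlusSet_empty, checkerOdd_eq_mix]

@[simp] lemma interlace_plusSet_mix (σ η : Config L) :
    interlace (plusSet (mix σ η)) (plusSet (mix η σ)) = σ := by
  rw [interlace, ofPlusSet_plusSet, ofPlusSet_plusSet, mix_mix]

/-- The energy of the pair of Ising configurations attached to the transition from `σ` to `η`. -/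
def pairEnergy (h : ℝ) (σ η : Config L) : ℝ :=
  excess h (plusSet (mix σ η)) + excess h (plusSet (mix η σ))

lemma pairEnergy_comm (h : ℝ) (σ η : Config L) : pairEnergy h σ η = pairEnergy h η σ :=
  add_comm _ _

lemma pairEnergy_interlace (h : ℝ) (s q : Finset (Torus L)) :
    pairEnergy h (interlace s q) (interlace q s) = excess h s + excess h q := by
  simp [pairEnergy]

end Mixing

/-! ### The weight of a transition -/

section Spins

variable {L : ℕ}

@[simp] lemma spin_one : spin 1 = 1 := by simp [spin]

@[simp] lemma spin_neg_one : spin (-1) = -1 := by simp [spin]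

lemma spin_eq (s : ℤˣ) : spin s = 2 * (if s = 1 then 1 else 0) - 1 := by
  rcases Int.units_eq_one_or s with rfl | rfl
  · norm_num
  · simp

lemma spin_mul_spin (s t : ℤˣ) :
    spin s * spin t = 1 - 2 * (if ¬ (s = 1 ↔ t = 1) then 1 else 0) := by
  rcases Int.units_eq_one_or s with rfl | rfl <;> rcases Int.units_eq_one_or t with rfl | rfl <;>
    norm_num

lemma spin_mul_add_pos {h : ℝ} (h_pos : 0 < h) (h_lt : h < 4) (s : ℤˣ) :
    0 < spin s * (4 * spin s + h) := by
  rcases Int.units_eq_one_or s with rfl | rfl <;> simp only [spin_one, spin_neg_one] <;> linarith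

lemma spin_mix_bond {e : Torus L} (he : ∀ x : Torus L, EvenSite (x + e) ↔ ¬ EvenSite x)
    (σ η : Config L) (x : Torus L) :
    spin (η x) * spin (σ (x + e)) + spin (η (x + e)) * spin (σ x) =
      spin (mix σ η x) * spin (mix σ η (x + e)) + spin (mix η σ x) * spin (mix η σ (x + e)) := by
  by_cases hx : EvenSite x <;> simp [mix, he, hx] <;> ring

lemma kernel_eq (hL : 2 < L) (z : Torus L) : kernel z =
    (if z = (1, 0) then 1 else 0) + (if z = (-1, 0) then 1 else 0) +
      (if z = (0, 1) then 1 else 0) + (if z = (0, -1) then 1 else 0) := by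
  have : Fact (1 < L) := ⟨by omega⟩
  have : Fact (2 < L) := ⟨hL⟩
  have h_ne : (1 : ZMod L) ≠ -1 := ZMod.neg_one_ne_one.symm
  unfold kernel
  by_cases hright : z = (1, 0)
  · simp [hright, h_ne]
  by_cases hleft : z = (-1, 0)
  · simp [hleft, h_ne.symm]
  by_cases hup : z = (0, 1)
  · simp [hup, h_ne]
  simp [hright, hleft, hup]

variable [NeZero L]

lemma sum_ite_sub_eq_mul_spin (e : Torus L) (σ : Config L) (x : Torus L) :
    ∑ y : Torus L, (if x - y = e then (1 : ℝ) else 0) * spin (σ y) = spin (σ (x - e)) := by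
  have hshift : ∀ y, x - y = e ↔ y = x - e := fun y => by
    rw [sub_eq_iff_eq_add, eq_sub_iff_add_eq', eq_comm]
  simp [hshift]

lemma localField_eq (hL : 2 < L) (σ : Config L) (x : Torus L) : localField σ x =
    spin (σ (x - (1, 0))) + spin (σ (x + (1, 0))) + spin (σ (x - (0, 1))) +
      spin (σ (x + (0, 1))) := by
  have hright : x - ((-1, 0) : Torus L) = x + (1, 0) := by ext <;> simp
  have hup : x - ((0, -1) : Torus L) = x + (0, 1) := by ext <;> simp
  simp only [localField, kernel_eq hL, add_mul, Finset.sum_add_distrib, sum_ite_sub_eq_mul_spin,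
    hright, hup]

lemma sum_spin (σ : Config L) : ∑ x, spin (σ x) = 2 * ((plusSet σ).card : ℝ) - (L : ℝ) ^ 2 := by
  have hcard : ((plusSet σ).card : ℝ) = ∑ x, if σ x = 1 then (1 : ℝ) else 0 := by
    simp [plusSet]
  simp only [spin_eq, Finset.sum_sub_distrib, ← Finset.mul_sum, hcard]
  simp [ZMod.card, sq]

lemma sum_spin_mix (σ η : Config L) :
    ∑ x, spin (σ x) + ∑ x, spin (η x) = ∑ x, spin (mix σ η x) + ∑ x, spin (mix η σ x) := by
  rw [← Finset.sum_add_distrib, ← Finset.sum_add_distrib]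
  refine Finset.sum_congr rfl fun x _ => ?_
  by_cases hx : EvenSite x <;> simp [mix, hx, add_comm]

lemma sum_spin_mul_right (σ : Config L) : ∑ x : Torus L, spin (σ x) * spin (σ (x + (1, 0))) =
    (L : ℝ) ^ 2 - 2 * ((∑ r, cycleBoundary (row (plusSet σ) r) : ℕ) : ℝ) := by
  have hrow : ∀ r, (cycleBoundary (row (plusSet σ) r) : ℝ) =
      ∑ x : ZMod L, if ¬ (σ (x, r) = 1 ↔ σ ((x, r) + (1, 0)) = 1) then 1 else 0 := fun r => by
    simp [cycleBoundary, Finset.card_filter]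
  simp only [spin_mul_spin, Finset.sum_sub_distrib, ← Finset.mul_sum, Fintype.sum_prod_type_right]
  push_cast
  simp only [hrow]
  simp [ZMod.card, sq]

lemma sum_spin_mul_up (σ : Config L) : ∑ x : Torus L, spin (σ x) * spin (σ (x + (0, 1))) =
    (L : ℝ) ^ 2 - 2 * ((∑ c, cycleBoundary (column (plusSet σ) c) : ℕ) : ℝ) := by
  have hcolumn : ∀ c, (cycleBoundary (column (plusSet σ) c) : ℝ) =
      ∑ y : ZMod L, if ¬ (σ (c, y) = 1 ↔ σ ((c, y) + (0, 1)) = 1) then 1 else 0 := fun c => by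
    simp [cycleBoundary, Finset.card_filter]
  simp only [spin_mul_spin, Finset.sum_sub_distrib, ← Finset.mul_sum, Fintype.sum_prod_type]
  push_cast
  simp only [hcolumn]
  simp [ZMod.card, sq]

lemma sum_spin_mix_bond {e : Torus L} (he : ∀ x : Torus L, EvenSite (x + e) ↔ ¬ EvenSite x)
    (σ η : Config L) :
    ∑ x, spin (η x) * (spin (σ (x - e)) + spin (σ (x + e))) =
      ∑ x, spin (mix σ η x) * spin (mix σ η (x + e)) +
        ∑ x, spin (mix η σ x) * spin (mix η σ (x + e)) := by
  have hshift : ∑ x, spin (η x) * spin (σ (x - e)) = ∑ x, spin (η (x + e)) * spin (σ x) := by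
    rw [← Equiv.sum_comp (Equiv.addRight e)]
    simp
  simp only [mul_add, Finset.sum_add_distrib]
  rw [hshift, add_comm, ← Finset.sum_add_distrib, ← Finset.sum_add_distrib]
  exact Finset.sum_congr rfl fun x _ => spin_mix_bond he σ η x

lemma sum_spin_mul_localField (hL : 2 < L) (h : ℝ) (σ η : Config L) :
    ∑ x, spin (η x) * (localField σ x + h) =
      ∑ x, spin (η x) * (spin (σ (x - (1, 0))) + spin (σ (x + (1, 0)))) +
        ∑ x, spin (η x) * (spin (σ (x - (0, 1))) + spin (σ (x + (0, 1)))) +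
          h * ∑ x, spin (η x) := by
  rw [Finset.mul_sum, ← Finset.sum_add_distrib, ← Finset.sum_add_distrib]
  refine Finset.sum_congr rfl fun x _ => ?_
  rw [localField_eq hL]
  ring

lemma sum_spin_add_sum_localField (hL : 2 < L) (hLe : Even L) (h : ℝ) (σ η : Config L) :
    h * ∑ x, spin (σ x) + ∑ x, spin (η x) * (localField σ x + h) =
      (4 - 2 * h) * (L : ℝ) ^ 2 - pairEnergy h σ η := by
  have hright : ∀ x : Torus L, EvenSite (x + (1, 0)) ↔ ¬ EvenSite x := fun x => by
    simpa [Prod.add_def] using evenSite_right hLe x.1 x.2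
  have hup : ∀ x : Torus L, EvenSite (x + (0, 1)) ↔ ¬ EvenSite x := fun x => by
    simpa [Prod.add_def] using evenSite_up hLe x.1 x.2
  have hmag := sum_spin_mix σ η
  rw [sum_spin (mix σ η), sum_spin (mix η σ)] at hmag
  rw [sum_spin_mul_localField hL, sum_spin_mix_bond hright, sum_spin_mix_bond hup]
  simp only [sum_spin_mul_right, sum_spin_mul_up, pairEnergy, excess, perimeter]
  push_cast
  linear_combination h * hmag

end Spins

section TransitionWeight

variable {L : ℕ} [NeZero L]

lemma one_div_one_add_exp (y : ℝ) :
    1 / (1 + Real.exp (-2 * y)) = Real.exp y / (2 * Real.cosh y) := by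
  have hsq : Real.exp (-2 * y) = Real.exp (-y) * Real.exp (-y) := by
    rw [← Real.exp_add]
    ring_nf
  have hinv : Real.exp y * Real.exp (-y) = 1 := by
    rw [← Real.exp_add, add_neg_cancel, Real.exp_zero]
  rw [Real.cosh_eq, mul_div_cancel₀ _ two_ne_zero,
    div_eq_div_iff (by positivity) (by positivity), hsq]
  linear_combination (-Real.exp (-y)) * hinv

lemma siteProb_eq (β h : ℝ) (σ : Config L) (x : Torus L) (s : ℤˣ) : siteProb β h σ x s =
    Real.exp (β * (spin s * (localField σ x + h))) /
      (2 * Real.cosh (β * (localField σ x + h))) := by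
  have hcosh : Real.cosh (β * (spin s * (localField σ x + h))) =
      Real.cosh (β * (localField σ x + h)) := by
    rcases Int.units_eq_one_or s with rfl | rfl
    · rw [spin_one, one_mul]
    · rw [spin_neg_one, neg_one_mul, mul_neg, Real.cosh_neg]
  rw [← hcosh, ← one_div_one_add_exp, siteProb]
  ring_nf

lemma transProb_eq (β h : ℝ) (σ η : Config L) : transProb β h σ η =
    Real.exp (β * ∑ x, spin (η x) * (localField σ x + h)) /
      (2 ^ Fintype.card (Torus L) * ∏ x, Real.cosh (β * (localField σ x + h))) := by
  simp only [transProb, siteProb_eq, Finset.prod_div_distrib, ← Real.exp_sum,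
    Finset.prod_mul_distrib, Finset.prod_const, Finset.mul_sum, Finset.card_univ]

lemma exp_neg_hamiltonian {β : ℝ} (hβ : β ≠ 0) (h : ℝ) (σ : Config L) :
    Real.exp (-β * hamiltonian β h σ) = Real.exp (β * (h * ∑ x, spin (σ x))) *
      ∏ x, Real.cosh (β * (localField σ x + h)) := by
  have hexponent : -β * hamiltonian β h σ = β * (h * ∑ x, spin (σ x)) +
      ∑ x, Real.log (Real.cosh (β * (localField σ x + h))) := by
    unfold hamiltonian
    field_simp
    ring
  rw [hexponent, Real.exp_add, Real.exp_sum]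
  congr 1
  exact Finset.prod_congr rfl fun x _ => Real.exp_log (Real.cosh_pos _)

/-- The common prefactor of the weights of all transitions. -/
def weightConst (L : ℕ) [NeZero L] (β h : ℝ) : ℝ :=
  Real.exp (β * ((4 - 2 * h) * (L : ℝ) ^ 2)) /
    (2 ^ Fintype.card (Torus L) * partitionFun L β h)

lemma partitionFun_pos (L : ℕ) [NeZero L] (β h : ℝ) : 0 < partitionFun L β h :=
  Finset.sum_pos (fun _ _ => Real.exp_pos _) Finset.univ_nonempty

lemma weightConst_pos (L : ℕ) [NeZero L] (β h : ℝ) : 0 < weightConst L β h :=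
  div_pos (Real.exp_pos _) (mul_pos (by positivity) (partitionFun_pos L β h))

lemma gibbs_mul_transProb (hL : 2 < L) (hLe : Even L) {β : ℝ} (hβ : β ≠ 0) (h : ℝ)
    (σ η : Config L) : gibbs β h σ * transProb β h σ η =
      weightConst L β h * Real.exp (-β * pairEnergy h σ η) := by
  have hcosh : (∏ x, Real.cosh (β * (localField σ x + h))) ≠ 0 :=
    Finset.prod_ne_zero_iff.2 fun x _ => (Real.cosh_pos _).ne'
  have hZ := (partitionFun_pos L β h).ne'
  have hexp : Real.exp (β * ((4 - 2 * h) * (L : ℝ) ^ 2)) * Real.exp (-β * pairEnergy h σ η) =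
      Real.exp (β * (h * ∑ x, spin (σ x))) *
        Real.exp (β * ∑ x, spin (η x) * (localField σ x + h)) := by
    rw [← Real.exp_add, ← Real.exp_add]
    congr 1
    linear_combination (-β) * sum_spin_add_sum_localField hL hLe h σ η
  rw [gibbs, exp_neg_hamiltonian hβ, transProb_eq, weightConst,
    div_mul_eq_mul_div _ _ (Real.exp _), hexp]
  field_simp

lemma capacity_eq (hL : 2 < L) (hLe : Even L) {β : ℝ} (hβ : β ≠ 0) (h Γ : ℝ)
    (A B : Finset (Config L)) : capacity β h A B = weightConst L β h * Real.exp (-β * Γ) *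
      networkCapacity (boltzmann (pairEnergy h) Γ β) A B := by
  have hconductance : (fun σ η : Config L => gibbs β h σ * transProb β h σ η) = fun σ η =>
      weightConst L β h * Real.exp (-β * Γ) * boltzmann (pairEnergy h) Γ β σ η := by
    funext σ η
    rw [gibbs_mul_transProb hL hLe hβ, boltzmann, mul_assoc, ← Real.exp_add]
    ring_nf
  calc capacity β h A B
      = networkCapacity (fun σ η => gibbs β h σ * transProb β h σ η) A B := rfl
    _ = _ := by
      rw [hconductance, networkCapacity_const_mul
        (mul_pos (weightConst_pos L β h) (Real.exp_pos _)).le]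

lemma tendsto_transProb (hL : 2 < L) {h : ℝ} (h_pos : 0 < h) (h_lt : h < 4) {σ η : Config L}
    (hσ : ∀ x : Torus L, σ (x - (1, 0)) = η x ∧ σ (x + (1, 0)) = η x ∧ σ (x - (0, 1)) = η x ∧
      σ (x + (0, 1)) = η x) :
    Tendsto (fun β => transProb β h σ η) atTop (𝓝 1) := by
  have hsite : ∀ x, Tendsto (fun β => siteProb β h σ x (η x)) atTop (𝓝 1) := fun x => by
    have hfield : localField σ x = 4 * spin (η x) := by
      obtain ⟨hleft, hright, hdown, hup⟩ := hσ x
      rw [localField_eq hL, hleft, hright, hdown, hup]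
      ring
    have hrate : ∀ β : ℝ, siteProb β h σ x (η x) =
        1 / (1 + Real.exp (-β * (2 * (spin (η x) * (4 * spin (η x) + h))))) := fun β => by
      rw [siteProb, hfield]
      ring_nf
    simp only [hrate]
    simpa using ((tendsto_exp_neg_mul (mul_pos two_pos
      (spin_mul_add_pos h_pos h_lt (η x)))).const_add 1).inv₀ (by norm_num)
  simpa [transProb] using tendsto_finsetProd Finset.univ fun x _ => hsite x

end TransitionWeight

/-! ### Cuts -/

section Empty

variable {L m : ℕ}

lemma subcritical_empty : Subcritical m (∅ : Finset (Torus L)) := Or.inl (by simp)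

/-- The spins of `σ` on the sites satisfying `Q` are those of an admissible subcritical set of
pluses. -/
def SubcriticalOn (Q : Torus L → Prop) (m : ℕ) (Adm : Finset (Torus L) → Prop) (σ : Config L) :
    Prop :=
  ∃ s, Subcritical m s ∧ Adm s ∧ ∀ x, Q x → (x ∈ s ↔ σ x = 1)

end Empty

section SubcriticalOn

variable {L m : ℕ} [NeZero L] {h : ℝ} {Adm : Finset (Torus L) → Prop} {Q : Torus L → Prop}
  {σ η : Config L} {s : Finset (Torus L)}

lemma evenSite_of_adjacent (hLe : Even L) (z : Torus L) (hz : ¬ EvenSite z) :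
    EvenSite (z.1, z.2 + 1) ∧ EvenSite (z.1, z.2 - 1) ∧ EvenSite (z.1 + 1, z.2) ∧
      EvenSite (z.1 - 1, z.2) := by
  simpa only [evenSite_up hLe, evenSite_down hLe, evenSite_right hLe, evenSite_left hLe, and_self]

lemma not_evenSite_of_adjacent (hLe : Even L) (z : Torus L) (hz : ¬ ¬ EvenSite z) :
    ¬ EvenSite (z.1, z.2 + 1) ∧ ¬ EvenSite (z.1, z.2 - 1) ∧ ¬ EvenSite (z.1 + 1, z.2) ∧
      ¬ EvenSite (z.1 - 1, z.2) := by
  simpa only [evenSite_up hLe, evenSite_down hLe, evenSite_right hLe, evenSite_left hLe, and_self]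

lemma SubcriticalOn.subcritical (hL : 1 < L) (h_pos : 0 < h) (h_lt : h < 1)
    (hAdm : Confining h m Adm) (hQ : ∀ z, ¬ Q z → Q (z.1, z.2 + 1) ∧ Q (z.1, z.2 - 1) ∧
      Q (z.1 + 1, z.2) ∧ Q (z.1 - 1, z.2)) (hσ : SubcriticalOn Q m Adm σ) (hs : Adm s)
    (hsσ : ∀ x, Q x → (x ∈ s ↔ σ x = 1)) : Subcritical m s := by
  obtain ⟨t, ht, htAdm, htσ⟩ := hσ
  exact hAdm.subcritical_of_forall_mem_iff hL h_pos h_lt hQ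
    (fun x hx => (htσ x hx).trans (hsσ x hx).symm) ht htAdm hs

lemma mem_plusSet_mix_of_evenSite (σ η : Config L) (x : Torus L) (hx : EvenSite x) :
    x ∈ plusSet (mix σ η) ↔ σ x = 1 := by
  rw [mem_plusSet, mix_of_evenSite hx]

lemma mem_plusSet_mix_of_not_evenSite (σ η : Config L) (x : Torus L) (hx : ¬ EvenSite x) :
    x ∈ plusSet (mix σ η) ↔ η x = 1 := by
  rw [mem_plusSet, mix_of_not_evenSite hx]

lemma subcritical_plusSet_mix_of_even (hL : 1 < L) (hLe : Even L) (h_pos : 0 < h) (h_lt : h < 1)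
    (hAdm : Confining h m Adm) (hσ : SubcriticalOn EvenSite m Adm σ)
    (hmix : Adm (plusSet (mix σ η))) : Subcritical m (plusSet (mix σ η)) :=
  hσ.subcritical hL h_pos h_lt hAdm (evenSite_of_adjacent hLe) hmix
    (mem_plusSet_mix_of_evenSite σ η)

lemma subcritical_plusSet_mix_of_odd (hL : 1 < L) (hLe : Even L) (h_pos : 0 < h) (h_lt : h < 1)
    (hAdm : Confining h m Adm) (hη : SubcriticalOn (¬ EvenSite ·) m Adm η)
    (hmix : Adm (plusSet (mix σ η))) : Subcritical m (plusSet (mix σ η)) :=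
  hη.subcritical hL h_pos h_lt hAdm (not_evenSite_of_adjacent hLe) hmix
    (mem_plusSet_mix_of_not_evenSite σ η)

lemma SubcriticalOn.odd_of_even (hL : 1 < L) (hLe : Even L) (h_pos : 0 < h) (h_lt : h < 1)
    (hAdm : Confining h m Adm) (hσ : SubcriticalOn EvenSite m Adm σ)
    (hmix : Adm (plusSet (mix σ η))) : SubcriticalOn (¬ EvenSite ·) m Adm η :=
  ⟨_, subcritical_plusSet_mix_of_even hL hLe h_pos h_lt hAdm hσ hmix, hmix,
    mem_plusSet_mix_of_not_evenSite σ η⟩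

lemma SubcriticalOn.even_of_odd (hL : 1 < L) (hLe : Even L) (h_pos : 0 < h) (h_lt : h < 1)
    (hAdm : Confining h m Adm) (hη : SubcriticalOn (¬ EvenSite ·) m Adm η)
    (hmix : Adm (plusSet (mix σ η))) : SubcriticalOn EvenSite m Adm σ :=
  ⟨_, subcritical_plusSet_mix_of_odd hL hLe h_pos h_lt hAdm hη hmix, hmix,
    mem_plusSet_mix_of_evenSite σ η⟩

lemma Confining.eq_empty_or_excess_pos (hm : 2 ≤ m) (hL : 2 * (m + 1) < L) (h_pos : 0 < h)
    (h_lt : h < 1) (hh : h * m ≤ 2) (hAdm : Confining h m Adm)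
    (hs : Adm s → Subcritical m s) : s = ∅ ∨ 0 < excess h s := by
  by_cases hsAdm : Adm s
  · exact s.eq_empty_or_nonempty.imp_right ((hs hsAdm).excess_pos hm hL h_pos h_lt hh)
  · exact Or.inr ((critEnergy_pos h_pos h_lt hh).trans_le (not_lt.1 fun hlt =>
      hsAdm (hAdm.of_lt _ hlt)))

lemma excess_univ_neg (h_pos : 0 < h) : excess h (Finset.univ : Finset (Torus L)) < 0 := by
  have hL : (0 : ℝ) < L := Nat.cast_pos.2 (NeZero.pos L)
  rw [excess_univ]
  nlinarith [mul_pos h_pos (pow_pos hL 2)]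

lemma not_subcritical_univ (hL : 2 * (m + 1) < L) :
    ¬ Subcritical m (Finset.univ : Finset (Torus L)) := fun hs => by
  have hcard := hs.card_le
  rw [card_torus] at hcard
  nlinarith

lemma subcriticalOn_of_minus (h_pos : 0 < h) (h_lt : h < 1) (hh : h * m ≤ 2)
    (hAdm : Confining h m Adm) (hσ : ∀ x, Q x → σ x = -1) : SubcriticalOn Q m Adm σ := by
  refine ⟨∅, subcritical_empty, hAdm.of_lt _ ?_, fun x hx => by simp [hσ x hx]⟩
  rw [excess_empty]
  exact critEnergy_pos h_pos h_lt hh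

lemma not_subcriticalOn_of_plus (hL : 2 * (m + 1) < L) (h_pos : 0 < h) (h_lt : h < 1)
    (hh : h * m ≤ 2) (hAdm : Confining h m Adm) (hQ : ∀ z, ¬ Q z → Q (z.1, z.2 + 1) ∧
      Q (z.1, z.2 - 1) ∧ Q (z.1 + 1, z.2) ∧ Q (z.1 - 1, z.2)) (hσ : ∀ x, Q x → σ x = 1) :
    ¬ SubcriticalOn Q m Adm σ := fun hsub =>
  not_subcritical_univ hL <| hsub.subcritical (by omega) h_pos h_lt hAdm hQ
    (hAdm.of_lt _ ((excess_univ_neg h_pos).trans (critEnergy_pos h_pos h_lt hh)))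
    fun x hx => by simp [hσ x hx]

end SubcriticalOn

section Cut

variable {L m : ℕ} [NeZero L] {h : ℝ} {Adm : Finset (Torus L) → Prop} {q : Finset (Torus L)}

/-- The transition from `σ` to `η` costs at least the critical energy above the energy of `q`, with
equality only if one of its two copies is inadmissible of critical energy and the other is `q`. -/
def CrossesBarrier (h : ℝ) (m : ℕ) (Adm : Finset (Torus L) → Prop) (q : Finset (Torus L))
    (σ η : Config L) : Prop :=
  critEnergy h m + excess h q ≤ pairEnergy h σ η ∧
    (pairEnergy h σ η = critEnergy h m + excess h q →
      (¬ Adm (plusSet (mix σ η)) ∧ excess h (plusSet (mix σ η)) = critEnergy h m ∧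
        plusSet (mix η σ) = q) ∨
      (¬ Adm (plusSet (mix η σ)) ∧ excess h (plusSet (mix η σ)) = critEnergy h m ∧
        plusSet (mix σ η) = q))

lemma CrossesBarrier.symm {σ η : Config L} (hση : CrossesBarrier h m Adm q σ η) :
    CrossesBarrier h m Adm q η σ := by
  rw [CrossesBarrier, pairEnergy_comm]
  exact ⟨hση.1, fun heq => (hση.2 heq).symm⟩

lemma crossesBarrier_of_not_adm (hAdm : Confining h m Adm) {σ η : Config L}
    (hσ : ¬ Adm (plusSet (mix σ η)))
    (hη : plusSet (mix η σ) = q ∨ excess h q < excess h (plusSet (mix η σ))) :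
    CrossesBarrier h m Adm q σ η := by
  have hcrit : critEnergy h m ≤ excess h (plusSet (mix σ η)) :=
    not_lt.1 fun hlt => hσ (hAdm.of_lt _ hlt)
  unfold CrossesBarrier pairEnergy
  rcases hη with rfl | hlt
  · exact ⟨by linarith, fun heq => Or.inl ⟨hσ, by linarith, rfl⟩⟩
  · exact ⟨by linarith, fun heq => by linarith⟩

/-- All jumps of `f₀` cross the barrier. -/
def IsCut (h : ℝ) (m : ℕ) (Adm : Finset (Torus L) → Prop) (q : Finset (Torus L))
    (f₀ : Config L → ℝ) : Prop :=
  ∀ σ η, f₀ σ ≠ f₀ η → CrossesBarrier h m Adm q σ η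

lemma exists_isCut_of_crossesBarrier {A B : Finset (Config L)} {P : Config L → Prop}
    (hA : ∀ σ ∈ A, P σ) (hB : ∀ σ ∈ B, ¬ P σ)
    (hP : ∀ σ η, P σ → ¬ P η → CrossesBarrier h m Adm q σ η) :
    ∃ f₀ ∈ potentials A B, IsCut h m Adm q f₀ := by
  classical
  refine ⟨fun σ => if P σ then 1 else 0, ⟨fun σ => ?_, fun σ hσ => if_pos (hA σ hσ),
    fun σ hσ => if_neg (hB σ hσ)⟩, fun σ η hne => ?_⟩
  · dsimp only
    split_ifs <;> simp
  · by_cases hσ : P σ <;> by_cases hη : P η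
    · simp [hσ, hη] at hne
    · exact hP σ η hσ hη
    · exact (hP η σ hη hσ).symm
    · simp [hσ, hη] at hne

lemma exists_isCut_allMinus (hm : 2 ≤ m) (hL : 2 * (m + 1) < L) (hLe : Even L) (h_pos : 0 < h)
    (h_lt : h < 1) (hh : h * m ≤ 2) (hAdm : Confining h m Adm) :
    ∃ f₀ ∈ potentials {allMinus L} (checkersPlus L), IsCut h m Adm ∅ f₀ := by
  have hL1 : 1 < L := by omega
  refine exists_isCut_of_crossesBarrier (P := fun σ => SubcriticalOn EvenSite m Adm σ ∧
    SubcriticalOn (¬ EvenSite ·) m Adm σ) ?_ ?_ fun σ η hσ hη => ?_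
  · simp only [Finset.mem_singleton, forall_eq]
    exact ⟨subcriticalOn_of_minus h_pos h_lt hh hAdm fun _ _ => rfl,
      subcriticalOn_of_minus h_pos h_lt hh hAdm fun _ _ => rfl⟩
  · have hEven : ∀ τ, ¬ SubcriticalOn EvenSite m Adm (mix (allPlus L) τ) := fun τ =>
      not_subcriticalOn_of_plus hL h_pos h_lt hh hAdm (evenSite_of_adjacent hLe)
        fun x hx => mix_of_evenSite hx _ _
    have hOdd : ¬ SubcriticalOn (¬ EvenSite ·) m Adm (mix (allMinus L) (allPlus L)) :=
      not_subcriticalOn_of_plus hL h_pos h_lt hh hAdm (not_evenSite_of_adjacent hLe)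
        fun x hx => mix_of_not_evenSite hx _ _
    simp only [checkersPlus, Finset.mem_insert, Finset.mem_singleton, forall_eq_or_imp, forall_eq,
      checkerEven_eq_mix, checkerOdd_eq_mix]
    exact ⟨fun hs => hEven _ hs.1, fun hs => hOdd hs.2,
      fun hs => hEven (allPlus L) (by rw [mix_self]; exact hs.1)⟩
  · have hmin : plusSet (mix σ η) = ∅ ∨ 0 < excess h (plusSet (mix σ η)) :=
      hAdm.eq_empty_or_excess_pos hm hL h_pos h_lt hh
        (subcritical_plusSet_mix_of_even hL1 hLe h_pos h_lt hAdm hσ.1)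
    have hmin' : plusSet (mix η σ) = ∅ ∨ 0 < excess h (plusSet (mix η σ)) :=
      hAdm.eq_empty_or_excess_pos hm hL h_pos h_lt hh
        (subcritical_plusSet_mix_of_odd hL1 hLe h_pos h_lt hAdm hσ.2)
    by_cases hmix : Adm (plusSet (mix σ η))
    · refine (crossesBarrier_of_not_adm hAdm (fun hmix' => hη ⟨?_, ?_⟩)
        (by rwa [excess_empty])).symm
      · exact hσ.2.even_of_odd hL1 hLe h_pos h_lt hAdm hmix'
      · exact hσ.1.odd_of_even hL1 hLe h_pos h_lt hAdm hmix
    · exact crossesBarrier_of_not_adm hAdm hmix (by rwa [excess_empty])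

lemma exists_isCut_checkers (hL : 2 * (m + 1) < L) (hLe : Even L) (h_pos : 0 < h) (h_lt : h < 1)
    (hh : h * m ≤ 2) (hAdm : Confining h m Adm) :
    ∃ f₀ ∈ potentials (checkers L) {allPlus L}, IsCut h m Adm Finset.univ f₀ := by
  have hL1 : 1 < L := by omega
  have hmin : ∀ s : Finset (Torus L), s = Finset.univ ∨ excess h Finset.univ < excess h s :=
    fun s => (le_or_gt (excess h s) _).imp_left (eq_univ_of_excess_le h_pos)
  refine exists_isCut_of_crossesBarrier (P := fun σ => SubcriticalOn EvenSite m Adm σ ∨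
    SubcriticalOn (¬ EvenSite ·) m Adm σ) ?_ ?_ fun σ η hσ hη => ?_
  · simp only [checkers, Finset.mem_insert, Finset.mem_singleton, forall_eq_or_imp, forall_eq,
      checkerEven_eq_mix, checkerOdd_eq_mix]
    exact ⟨Or.inr
        (subcriticalOn_of_minus h_pos h_lt hh hAdm fun _ hx => mix_of_not_evenSite hx _ _),
      Or.inl (subcriticalOn_of_minus h_pos h_lt hh hAdm fun _ hx => mix_of_evenSite hx _ _)⟩
  · simp only [Finset.mem_singleton, forall_eq, not_or]
    exact ⟨not_subcriticalOn_of_plus hL h_pos h_lt hh hAdm (evenSite_of_adjacent hLe)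
        fun _ _ => rfl,
      not_subcriticalOn_of_plus hL h_pos h_lt hh hAdm (not_evenSite_of_adjacent hLe)
        fun _ _ => rfl⟩
  · rw [not_or] at hη
    rcases hσ with hσ | hσ
    · exact crossesBarrier_of_not_adm hAdm
        (fun hmix => hη.2 (hσ.odd_of_even hL1 hLe h_pos h_lt hAdm hmix)) (hmin _)
    · exact (crossesBarrier_of_not_adm hAdm
        (fun hmix => hη.1 (hσ.even_of_odd hL1 hLe h_pos h_lt hAdm hmix)) (hmin _)).symm

end Cut

/-! ### Passages across the barrier -/

section Passages

variable {L m : ℕ} [NeZero L] {h Γ : ℝ} {K : Set ℝ} {s t q : Finset (Torus L)}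
  {A B : Finset (Config L)} {σ η : Config L}

/-- Connectedness through transitions whose energy, measured from that of the spectator `q`, lies
in `K`. The spectator is empty for the exit from `d` and full for the exit from `c`. -/
def Linked (h : ℝ) (K : Set ℝ) (q : Finset (Torus L)) : Config L → Config L → Prop :=
  Relation.EqvGen fun σ η => pairEnergy h σ η - excess h q ∈ K

lemma Linked.eqvGen {r : Config L → Config L → Prop} (hση : Linked h K q σ η)
    (hr : ∀ σ η, pairEnergy h σ η - excess h q ∈ K → r σ η) : Relation.EqvGen r σ η :=
  Relation.EqvGen.mono hr _ _ hση

lemma linked_interlace_swap (hs : excess h s ∈ K) (q : Finset (Torus L)) :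
    Linked h K q (interlace s q) (interlace q s) :=
  Relation.EqvGen.rel _ _ (by rwa [pairEnergy_interlace, add_sub_cancel_right])

/-- Adding a site to a droplet changes only one of the two configurations of its pair, so a growth
is followed by steps between the two configurations of a pair. -/
lemma linked_of_grow (hst : Grow h K s t) (hs : excess h s ∈ K) (q : Finset (Torus L)) :
    Linked h K q (interlace s q) (interlace t q) ∧
      Linked h K q (interlace t q) (interlace q t) := by
  induction hst with
  | refl => exact ⟨Relation.EqvGen.refl _, linked_interlace_swap hs q⟩
  | tail _ hstep ih =>
    obtain ⟨hE, z, -, rfl⟩ := hstep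
    have hswap := linked_interlace_swap hE q
    refine ⟨ih.1.trans _ _ _ ?_, hswap⟩
    by_cases hz : EvenSite z
    · rw [interlace_insert_of_evenSite hz] at hswap
      exact ih.2.trans _ _ _ (hswap.symm _ _)
    · rw [interlace_insert_of_not_evenSite hz]
      exact Relation.EqvGen.refl _

lemma linked_of_isGate (hΓ : 0 < Γ) (hs : IsGate h Γ s) (q : Finset (Torus L)) :
    (Linked h (Set.Iio Γ) q (interlace ∅ q) (interlace s q) ∧
        Linked h (Set.Iio Γ) q (interlace Finset.univ q) (interlace q s)) ∨
      (Linked h (Set.Iio Γ) q (interlace ∅ q) (interlace q s) ∧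
        Linked h (Set.Iio Γ) q (interlace Finset.univ q) (interlace s q)) := by
  obtain ⟨R, z, y, -, rfl, -, hparity, hR, hE, huniv⟩ := hs
  obtain ⟨hR₁, hR₂⟩ := linked_of_grow hR (by simpa using hΓ) q
  obtain ⟨hy₁, -⟩ := linked_of_grow huniv hE q
  have hy₂ := linked_interlace_swap (K := Set.Iio Γ) hE q
  by_cases hz : EvenSite z
  · have hy : ¬ EvenSite y := fun hy => hparity.1 hy hz
    rw [interlace_insert_of_not_evenSite hy] at hy₁
    rw [interlace_insert_of_evenSite hz]
    exact Or.inr ⟨hR₁.trans _ _ _ hR₂, hy₁.symm _ _⟩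
  · have hy : EvenSite y := hparity.2 hz
    rw [interlace_insert_of_evenSite hy] at hy₂
    rw [interlace_insert_of_not_evenSite hz]
    exact Or.inl ⟨hR₁, (hy₁.symm _ _).trans _ _ _ hy₂⟩

/-- The oriented transitions whose pair of Ising configurations consists of a critical droplet and
of the spectator `q`. -/
def critTransitions (m : ℕ) (q : Finset (Torus L)) : Finset (Config L × Config L) :=
  ((critDroplets L m).image fun s => (interlace s q, interlace q s)) ∪
    (critDroplets L m).image fun s => (interlace q s, interlace s q)

lemma mem_critTransitions {p : Config L × Config L} :
    p ∈ critTransitions m q ↔ ∃ s ∈ critDroplets L m,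
      p = (interlace s q, interlace q s) ∨ p = (interlace q s, interlace s q) := by
  simp only [critTransitions, Finset.mem_union, Finset.mem_image, and_or_left, exists_or,
    eq_comm (a := p)]

lemma mem_critTransitions_of_plusSet_mix (hs : plusSet (mix σ η) ∈ critDroplets L m)
    (hq : plusSet (mix η σ) = q) :
    (σ, η) ∈ critTransitions m q ∧ (η, σ) ∈ critTransitions m q := by
  subst hq
  exact ⟨mem_critTransitions.2 ⟨_, hs, by simp⟩, mem_critTransitions.2 ⟨_, hs, by simp⟩⟩

lemma mem_critTransitions_of_crossesBarrier
    (hσ : CrossesBarrier h m (fun s => excess h s ≤ critEnergy h m ∧ s ∉ critDroplets L m) q σ η)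
    (hE : pairEnergy h σ η = critEnergy h m + excess h q) : (σ, η) ∈ critTransitions m q := by
  rcases hσ.2 hE with ⟨hAdm, hcrit, hq⟩ | ⟨hAdm, hcrit, hq⟩
  · exact (mem_critTransitions_of_plusSet_mix
      (of_not_not fun hmem => hAdm ⟨hcrit.le, hmem⟩) hq).1
  · exact (mem_critTransitions_of_plusSet_mix
      (of_not_not fun hmem => hAdm ⟨hcrit.le, hmem⟩) hq).2

lemma card_critTransitions (hq : q ∉ critDroplets L m) :
    (critTransitions m q).card = 2 * (critDroplets L m).card := by
  have hinj : ∀ {s q s' q' : Finset (Torus L)}, interlace s q = interlace s' q' →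
      interlace q s = interlace q' s' → s = s' := fun {s q s' q'} hsq hqs => by
    rw [← plusSet_ofPlusSet s, ← mix_interlace s q, hsq, hqs, mix_interlace, plusSet_ofPlusSet]
  rw [critTransitions, Finset.card_union_of_disjoint, Finset.card_image_of_injective,
    Finset.card_image_of_injective, two_mul]
  · exact fun s s' hss' => hinj (Prod.mk.inj hss').2 (Prod.mk.inj hss').1
  · exact fun s s' hss' => hinj (Prod.mk.inj hss').1 (Prod.mk.inj hss').2
  · rw [Finset.disjoint_left]
    simp only [Finset.mem_image, not_exists, not_and, forall_exists_index, and_imp]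
    rintro _ s hs rfl s' - hss'
    exact hq (hinj (Prod.mk.inj hss').1 (Prod.mk.inj hss').2 ▸ hs)

lemma pairEnergy_of_mem_critTransitions (hm : 0 < m) (hL : 2 * (m + 1) < L) (h : ℝ)
    {p : Config L × Config L} (hp : p ∈ critTransitions m q) :
    pairEnergy h p.1 p.2 = critEnergy h m + excess h q := by
  obtain ⟨s, hs, rfl | rfl⟩ := mem_critTransitions.1 hp
  · rw [pairEnergy_interlace, excess_of_mem_critDroplets hm hL h hs]
  · rw [pairEnergy_interlace, excess_of_mem_critDroplets hm hL h hs, add_comm]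

theorem exists_pos_tendsto_networkCapacity_pairEnergy (hm : 2 ≤ m) (hL : 2 * (m + 1) < L)
    (h_pos : 0 < h) (h_lt : h < 1) (hh : h * m ≤ 2) (hh' : 2 < h * (m + 1))
    (ha : interlace ∅ q ∈ A) (hb : interlace Finset.univ q ∈ B)
    (hcut : ∀ Adm, Confining h m Adm → ∃ f₀ ∈ potentials A B, IsCut h m Adm q f₀) :
    ∃ k : ℝ, 0 < k ∧ Tendsto (fun β => networkCapacity
      (boltzmann (pairEnergy h) (critEnergy h m + excess h q) β) A B) atTop (𝓝 k) := by
  obtain ⟨f₀, hf₀, hf₀cut⟩ := hcut _ (confining_lt hm hL h_pos hh)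
  have hlink : Linked h (Set.Iic (critEnergy h m)) q (interlace ∅ q) (interlace Finset.univ q) :=
    (linked_of_grow (grow_empty_univ (by omega) (by omega) h_pos hh hh')
      (by simpa using (critEnergy_pos h_pos h_lt hh).le) q).1
  exact exists_pos_tendsto_networkCapacity hf₀ (fun σ η hne => (hf₀cut σ η hne).1) ha hb
    (hlink.eqvGen fun σ η hE => sub_le_iff_le_add.1 hE)

theorem tendsto_networkCapacity_pairEnergy (hm : 2 ≤ m) (hL : 2 * (m + 1) < L) (hLe : Even L)
    (h_pos : 0 < h) (h_lt : h < 1) (hh : h * m < 2) (hh' : 2 < h * (m + 1)) (hq : excess h q ≤ 0)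
    (ha : interlace ∅ q ∈ A) (hb : interlace Finset.univ q ∈ B)
    (hcut : ∀ Adm, Confining h m Adm → ∃ f₀ ∈ potentials A B, IsCut h m Adm q f₀) :
    Tendsto (fun β => networkCapacity
      (boltzmann (pairEnergy h) (critEnergy h m + excess h q) β) A B) atTop
      (𝓝 (4 * ((m : ℝ) + 1) * (L : ℝ) ^ 2)) := by
  have hpos := critEnergy_pos h_pos h_lt hh.le
  have hqcrit : q ∉ critDroplets L m := fun hmem => by
    linarith [excess_of_mem_critDroplets (by omega) hL h hmem]
  obtain ⟨f₀, hf₀, hf₀cut⟩ := hcut _ (confining_notMem_critDroplets hm hL h_pos hh)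
  have hlink : ∀ {σ η : Config L}, Linked h (Set.Iio (critEnergy h m)) q σ η →
      Relation.EqvGen (fun σ η => pairEnergy h σ η < critEnergy h m + excess h q) σ η :=
    fun hση => hση.eqvGen fun _ _ hE => sub_lt_iff_lt_add.1 hE
  have hgate : ∀ s ∈ critDroplets L m, _ := fun s hs =>
    (linked_of_isGate hpos (isGate_of_mem_critDroplets hm hL hLe h_pos hh hh' hs) q).imp
      (And.imp hlink hlink) (And.imp hlink hlink)
  have hlim := tendsto_networkCapacity_card_div_two hf₀ (fun σ η hne => (hf₀cut σ η hne).1)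
    (fun σ η hne => mem_critTransitions_of_crossesBarrier (hf₀cut σ η hne))
    (fun p hp => pairEnergy_of_mem_critTransitions (by omega) hL h hp) ha hb fun p hp => by
      obtain ⟨s, hs, rfl | rfl⟩ := mem_critTransitions.1 hp
      · exact hgate s hs
      · exact (hgate s hs).symm
  rw [card_critTransitions hqcrit, card_critDroplets hm (by omega)] at hlim
  convert hlim using 2
  push_cast
  ring

lemma exists_networkCapacity_limit (hm : 2 ≤ m) (hL : 2 * (m + 1) < L) (hLe : Even L)
    (h_pos : 0 < h) (h_lt : h < 1) (hh : h * m ≤ 2) (hh' : 2 < h * (m + 1)) (hq : excess h q ≤ 0)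
    (ha : interlace ∅ q ∈ A) (hb : interlace Finset.univ q ∈ B)
    (hcut : ∀ Adm, Confining h m Adm → ∃ f₀ ∈ potentials A B, IsCut h m Adm q f₀) :
    ∃ k : ℝ, 0 < k ∧ (h * m < 2 → k = 4 * ((m : ℝ) + 1) * (L : ℝ) ^ 2) ∧
      Tendsto (fun β => networkCapacity
        (boltzmann (pairEnergy h) (critEnergy h m + excess h q) β) A B) atTop (𝓝 k) := by
  obtain ⟨k, hk, hlim⟩ :=
    exists_pos_tendsto_networkCapacity_pairEnergy hm hL h_pos h_lt hh hh' ha hb hcut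
  exact ⟨k, hk, fun hlt => tendsto_nhds_unique hlim
    (tendsto_networkCapacity_pairEnergy hm hL hLe h_pos h_lt hlt hh' hq ha hb hcut), hlim⟩

end Passages

/-! ### Sharp asymptotics -/

section CriticalLength

variable {h : ℝ}

lemma activationEnergy_eq (h : ℝ) : activationEnergy h = critEnergy h ⌊2 / h⌋₊ := by
  rw [activationEnergy, critEnergy, critLength]
  push_cast
  ring

lemma two_le_floor_two_div (h_pos : 0 < h) (h_lt : h < 1) : 2 ≤ ⌊2 / h⌋₊ :=
  Nat.le_floor <| by
    rw [le_div_iff₀ h_pos]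
    push_cast
    linarith

lemma mul_floor_two_div_le (h_pos : 0 < h) : h * ⌊2 / h⌋₊ ≤ 2 :=
  (le_div_iff₀' h_pos).1 (Nat.floor_le (by positivity))

lemma lt_mul_floor_two_div_add_one (h_pos : 0 < h) : 2 < h * ((⌊2 / h⌋₊ : ℝ) + 1) :=
  (div_lt_iff₀' h_pos).1 (Nat.lt_floor_add_one _)

lemma mul_floor_two_div_lt (h_pos : 0 < h) (hint : ∀ n : ℕ, 2 / h ≠ (n : ℝ)) :
    h * ⌊2 / h⌋₊ < 2 :=
  (mul_floor_two_div_le h_pos).lt_of_ne fun heq => hint ⌊2 / h⌋₊ <| by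
    rw [div_eq_iff h_pos.ne', mul_comm, heq]

end CriticalLength

lemma checkerEven_ne_checkerOdd (L : ℕ) : checkerEven L ≠ checkerOdd L := fun heq => by
  simpa [checkerEven, checkerOdd] using congrFun heq 0

section Asymptotics

variable {L m : ℕ} [NeZero L] {h : ℝ}

lemma tendsto_transProb_allMinus (hL : 2 < L) (h_pos : 0 < h) (h_lt : h < 4) :
    Tendsto (fun β => transProb β h (allMinus L) (allMinus L)) atTop (𝓝 1) :=
  tendsto_transProb hL h_pos h_lt fun _ => ⟨rfl, rfl, rfl, rfl⟩

lemma tendsto_transProb_mix (hL : 2 < L) (hLe : Even L) (h_pos : 0 < h) (h_lt : h < 4)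
    (a b : ℤˣ) : Tendsto (fun β => transProb β h (mix (fun _ => a) (fun _ => b))
      (mix (L := L) (fun _ => b) (fun _ => a))) atTop (𝓝 1) := by
  have hflip : ∀ x y : Torus L, (EvenSite y ↔ ¬ EvenSite x) →
      mix (fun _ => a) (fun _ => b) y = mix (L := L) (fun _ => b) (fun _ => a) x := by
    intro x y hxy
    by_cases hx : EvenSite x
    · rw [mix_of_evenSite hx, mix_of_not_evenSite (hxy.not.2 (not_not.2 hx))]
    · rw [mix_of_not_evenSite hx, mix_of_evenSite (hxy.2 hx)]
  refine tendsto_transProb hL h_pos h_lt fun x =>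
    ⟨hflip _ _ ?_, hflip _ _ ?_, hflip _ _ ?_, hflip _ _ ?_⟩
  · simpa [Prod.sub_def] using evenSite_left hLe x.1 x.2
  · simpa [Prod.add_def] using evenSite_right hLe x.1 x.2
  · simpa [Prod.sub_def] using evenSite_down hLe x.1 x.2
  · simpa [Prod.add_def] using evenSite_up hLe x.1 x.2

lemma transProb_pos (β h : ℝ) (σ η : Config L) : 0 < transProb β h σ η :=
  Finset.prod_pos fun x _ => by unfold siteProb; positivity

lemma gibbs_eq_mul_inv (hL : 2 < L) (hLe : Even L) {β : ℝ} (hβ : β ≠ 0) (h : ℝ)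
    (σ η : Config L) : gibbs β h σ =
      weightConst L β h * Real.exp (-β * pairEnergy h σ η) * (transProb β h σ η)⁻¹ := by
  rw [← gibbs_mul_transProb hL hLe hβ, mul_inv_cancel_right₀ (transProb_pos β h σ η).ne']

lemma isEquivalent_div_capacity (hL : 2 < L) (hLe : Even L) {Γ X k c : ℝ} (hk : 0 < k)
    (hc : 0 < c) {A B : Finset (Config L)} {M r : ℝ → ℝ}
    (hlim : Tendsto (fun β => networkCapacity (boltzmann (pairEnergy h) (Γ + X) β) A B) atTop
      (𝓝 k))
    (hr : Tendsto r atTop (𝓝 c))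
    (hM : ∀ β : ℝ, 0 < β → M β = weightConst L β h * Real.exp (-β * X) * r β) :
    Asymptotics.IsEquivalent atTop (fun β => M β / capacity β h A B)
      (fun β => Real.exp (β * Γ) / (k / c)) := by
  refine Asymptotics.isEquivalent_of_tendsto_one ?_
  have hratio : Tendsto (fun β => r β /
      networkCapacity (boltzmann (pairEnergy h) (Γ + X) β) A B * (k / c)) atTop (𝓝 1) := by
    have := (hr.div hlim hk.ne').mul_const (k / c)
    rwa [div_mul_div_cancel₀ hk.ne', div_self hc.ne'] at this
  refine hratio.congr' ?_
  filter_upwards [eventually_gt_atTop 0, hlim.eventually (lt_mem_nhds hk)] with β hβ hpos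
  have hw := (weightConst_pos L β h).ne'
  have hexp : Real.exp (-β * (Γ + X)) = Real.exp (-β * X) * (Real.exp (β * Γ))⁻¹ := by
    rw [← Real.exp_neg, ← Real.exp_add]
    congr 1
    ring
  rw [Pi.div_apply, hM β hβ, capacity_eq hL hLe hβ.ne' h (Γ + X), hexp]
  field_simp

theorem exists_isEquivalent_allMinus (hm : 2 ≤ m) (hL : 2 * (m + 1) < L) (hLe : Even L)
    (h_pos : 0 < h) (h_lt : h < 1) (hh : h * m ≤ 2) (hh' : 2 < h * (m + 1)) :
    ∃ k : ℝ, 0 < k ∧ (h * m < 2 → k = 4 * ((m : ℝ) + 1) * (L : ℝ) ^ 2) ∧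
      Asymptotics.IsEquivalent atTop
        (fun β => gibbs β h (allMinus L) / capacity β h {allMinus L} (checkersPlus L))
        (fun β => Real.exp (β * critEnergy h m) / k) := by
  obtain ⟨k, hk, hval, hlim⟩ := exists_networkCapacity_limit (q := ∅) (A := {allMinus L})
    (B := checkersPlus L) hm hL hLe h_pos h_lt hh hh' (by simp) (by simp)
    (by simp [checkersPlus, interlace_univ_empty])
    fun _ => exists_isCut_allMinus hm hL hLe h_pos h_lt hh
  have hstay := (tendsto_transProb_allMinus (L := L) (by omega) h_pos (by linarith)).inv₀
    one_ne_zero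
  refine ⟨k, hk, hval, ?_⟩
  have henergy : pairEnergy h (allMinus L) (allMinus L) = excess h (∅ : Finset (Torus L)) := by
    simpa using pairEnergy_interlace h (∅ : Finset (Torus L)) ∅
  simpa using isEquivalent_div_capacity (by omega) hLe hk (inv_pos.2 one_pos) hlim hstay
    fun β hβ => by rw [gibbs_eq_mul_inv (by omega) hLe hβ.ne' h _ (allMinus L), henergy]

lemma pairEnergy_checkers (h : ℝ) :
    pairEnergy h (checkerEven L) (checkerOdd L) = excess h (Finset.univ : Finset (Torus L)) := by
  rw [← interlace_univ_empty, ← interlace_empty_univ, pairEnergy_interlace, excess_empty, add_zero]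

lemma gibbsSet_checkers (hL : 2 < L) (hLe : Even L) {β : ℝ} (hβ : β ≠ 0) (h : ℝ) :
    gibbsSet β h (checkers L) =
      weightConst L β h * Real.exp (-β * excess h (Finset.univ : Finset (Torus L))) *
        ((transProb β h (checkerEven L) (checkerOdd L))⁻¹ +
          (transProb β h (checkerOdd L) (checkerEven L))⁻¹) := by
  have hpair : gibbsSet β h (checkers L) =
      gibbs β h (checkerEven L) + gibbs β h (checkerOdd L) := by
    unfold gibbsSet checkers
    convert Finset.sum_pair (checkerEven_ne_checkerOdd L)
  rw [hpair, gibbs_eq_mul_inv hL hLe hβ h (checkerEven L) (checkerOdd L),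
    gibbs_eq_mul_inv hL hLe hβ h (checkerOdd L) (checkerEven L), pairEnergy_comm h (checkerOdd L),
    pairEnergy_checkers, mul_add]

theorem exists_isEquivalent_checkers (hm : 2 ≤ m) (hL : 2 * (m + 1) < L) (hLe : Even L)
    (h_pos : 0 < h) (h_lt : h < 1) (hh : h * m ≤ 2) (hh' : 2 < h * (m + 1)) :
    ∃ k : ℝ, 0 < k ∧ (h * m < 2 → k = 2 * ((m : ℝ) + 1) * (L : ℝ) ^ 2) ∧
      Asymptotics.IsEquivalent atTop
        (fun β => gibbsSet β h (checkers L) / capacity β h (checkers L) {allPlus L})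
        (fun β => Real.exp (β * critEnergy h m) / k) := by
  obtain ⟨k, hk, hval, hlim⟩ := exists_networkCapacity_limit (q := Finset.univ) (A := checkers L)
    (B := {allPlus L}) hm hL hLe h_pos h_lt hh hh' (excess_univ_neg h_pos).le
    (by simp [checkers, interlace_empty_univ]) (by simp)
    fun _ => exists_isCut_checkers hL hLe h_pos h_lt hh
  have hflip : Tendsto (fun β => (transProb β h (checkerEven L) (checkerOdd L))⁻¹ +
      (transProb β h (checkerOdd L) (checkerEven L))⁻¹) atTop (𝓝 (1⁻¹ + 1⁻¹)) := by
    rw [checkerEven_eq_mix, checkerOdd_eq_mix]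
    have htrans := tendsto_transProb_mix (by omega) hLe h_pos (by linarith)
    exact ((htrans 1 (-1)).inv₀ one_ne_zero).add ((htrans (-1) 1).inv₀ one_ne_zero)
  refine ⟨k / (1⁻¹ + 1⁻¹), by positivity, fun hlt => by rw [hval hlt]; ring, ?_⟩
  exact isEquivalent_div_capacity (by omega) hLe hk (by norm_num) hlim hflip
    fun β hβ => gibbsSet_checkers (by omega) hLe hβ.ne' h

end Asymptotics

end PCA

end

theorem mainTheorem2 (L : ℕ) [NeZero L] (hL : Even L) (h : ℝ) (h_pos : 0 < h) (h_lt : h < 1)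
    (hlarge : 2 * PCA.critLength h < L) :
    ∃ k₁ k₂ : ℝ, 0 < k₁ ∧ 0 < k₂ ∧
      Asymptotics.IsEquivalent Filter.atTop
        (fun β : ℝ => PCA.gibbs β h (PCA.allMinus L) /
          PCA.capacity β h {PCA.allMinus L} (PCA.checkersPlus L))
        (fun β : ℝ => Real.exp (β * PCA.activationEnergy h) / k₂) ∧
      Asymptotics.IsEquivalent Filter.atTop
        (fun β : ℝ => PCA.gibbsSet β h (PCA.checkers L) /
          PCA.capacity β h (PCA.checkers L) {PCA.allPlus L})
        (fun β : ℝ => Real.exp (β * PCA.activationEnergy h) / k₁) ∧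
      ((∀ n : ℕ, 2 / h ≠ (n : ℝ)) →
        k₂ = 4 * (PCA.critLength h : ℝ) * (L : ℝ) ^ 2 ∧
        k₁ = 2 * (PCA.critLength h : ℝ) * (L : ℝ) ^ 2) := by
  have hm := PCA.two_le_floor_two_div h_pos h_lt
  have hh := PCA.mul_floor_two_div_le h_pos
  have hh' := PCA.lt_mul_floor_two_div_add_one h_pos
  obtain ⟨k₂, hk₂, hval₂, hequiv₂⟩ :=
    PCA.exists_isEquivalent_allMinus hm hlarge hL h_pos h_lt hh hh'
  obtain ⟨k₁, hk₁, hval₁, hequiv₁⟩ :=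
    PCA.exists_isEquivalent_checkers hm hlarge hL h_pos h_lt hh hh'
  rw [← PCA.activationEnergy_eq] at hequiv₁ hequiv₂
  have hlen : (PCA.critLength h : ℝ) = ⌊2 / h⌋₊ + 1 := Nat.cast_succ _
  refine ⟨k₁, k₂, hk₁, hk₂, hequiv₂, hequiv₁, fun hint => ?_⟩
  rw [hlen]
  have hlt := PCA.mul_floor_two_div_lt h_pos hint
  exact ⟨hval₂ hlt, hval₁ hlt⟩
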